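/- Work on flat Euclidean $\mathbb R^3$ with metric $\delta_{\mu\nu}$ and antisymmetric symbol $\varepsilon_{\mu\nu\rho}$, $\varepsilon_{012}=1$; repeated indices are summed. Let $g\in\mathbb R$. For a gauge field $A_\mu$ with values in a semisimple real Lie algebra $\mathfrak g$ of antihermitian complex $N\times N$ matrices put $$F_{\mu\nu}=\partial_\mu A_\nu-\partial_\nu A_\mu+g[A_\mu,A_\nu],\qquad D_\mu=\partial_\mu+g[A_\mu,\,\cdot\,],$$ $$\mathcal S_{CS}(A)=\tfrac12\,\mathrm{tr}\!\int d^3x\,\varepsilon^{\mu\nu\rho}\bigl(A_\mu\partial_\nu A_\rho+\tfrac23 g A_\mu A_\nu A_\rho\bigr).$$ A \emph{local covariant tensor} is a formal expression obtained from $F$ by finitely many covariant derivatives $D$, commutators, real linear combinations, multiplications by $\varepsilon$ and $\delta$, contractions and rearrangements of indices; it can be evaluated on every smooth gauge field. \textbf{Lemma.} For every $g$ there are local covariant vectors $\vartheta^n_\mu(D,F)$, $n\ge1$, the same for all $N$, $\mathfrak g$ and $A$, such that the following holds. (a) For every smooth $\mathfrak g$-valued $A$, \begin{align*} \vartheta^1_\mu&=\tfrac14\varepsilon_{\mu\sigma\tau}F^{\sigma\tau},\qquad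 \vartheta^2_\mu=\tfrac18D^\sigma F_{\sigma\mu},\\ \vartheta^3_\mu&=-\tfrac1{16}\varepsilon_{\mu\sigma\tau}D^\sigma D_\rho F^{\rho\tau}+\tfrac g{48}\varepsilon_{\mu\sigma\tau}[F^{\sigma\rho},F_\rho{}^{\tau}],\\ \vartheta^4_\mu&=-\tfrac5{128}D^2D^\rho F_{\rho\mu}+\tfrac5{128}D^\nu D_\mu D^\lambda F_{\lambda\nu}-\tfrac7{192}g[D^\rho F_{\rho\tau},F_\mu{}^{\tau}]-\tfrac1{48}g[D_\nu F_{\mu\lambda},F^{\lambda\nu}]. \end{align*} (b) For every smooth $\mathfrak g$-valued $A$, every $\vartheta^n_\mu$ is $\mathfrak g$-valued and transforms covariantly: for every smooth $\mathfrak g$-valued $c$, under the infinitesimal gauge transformation $\delta A_\mu=D_\mu c$ one has $\delta\vartheta^n_\mu=g[\vartheta^n_\mu,c]$ pointwise. (c) For every $\mathfrak g$-valued $A$ with Schwartz entries let $\widehat A_\mu=A_\mu+\sum_{n\ge1}m^{-n}\vartheta^n_\mu$, a formal power series in $1/m$, and let $\mathcal S_{CS}(\widehat A)$ be computed order by order in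 $1/m$. All the densities involved are integrable, and $$\mathcal S_{CS}(\widehat A)=\mathcal S_{CS}(A)+\frac1{4m}\,\mathrm{tr}\!\int d^3x\,F_{\mu\nu}F^{\mu\nu}$$ as an identity of formal power series in $1/m$. -/

import Mathlib

open scoped ContDiff SchwartzMap

attribute [local instance 100] LieRing.ofAssociativeRing

noncomputable section

namespace ChernSimonsYM

/-- Flat Euclidean three-dimensional space with its metric `diag(+,+,+)`. Because the metric is
the identity, upper and lower indices are not distinguished below. -/
abbrev Space : Type := EuclideanSpace ℝ (Fin 3)

/-- The complex `N × N` matrices, in which the generators of the gauge group live. -/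
abbrev Mat (N : ℕ) : Type := Matrix (Fin N) (Fin N) ℂ

/-- The totally antisymmetric symbol, `ε₀₁₂ = 1`. -/
def leviCivita (i j k : Fin 3) : ℝ :=
  (((j : ℕ) : ℝ) - ((i : ℕ) : ℝ)) * (((k : ℕ) : ℝ) - ((i : ℕ) : ℝ)) *
    (((k : ℕ) : ℝ) - ((j : ℕ) : ℝ)) / 2

/-- Partial derivative `∂_μ φ` of a matrix valued function, taken entrywise. -/
def partialD {N : ℕ} (μ : Fin 3) (φ : Space → Mat N) : Space → Mat N :=
  fun x => Matrix.of fun i j =>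
    fderiv ℝ (fun y => φ y i j) x (EuclideanSpace.single μ (1 : ℝ))

/-- Smooth matrix valued functions. -/
def IsSmooth {N : ℕ} (φ : Space → Mat N) : Prop :=
  ∀ i j, ContDiff ℝ ∞ (fun x => φ x i j)

/-- Matrix valued functions that are, together with all derivatives, rapidly decreasing. -/
def IsSchwartz {N : ℕ} (φ : Space → Mat N) : Prop :=
  ∀ i j, ∃ f : 𝓢(Space, ℂ), ∀ x, f x = φ x i j

/-- The field strength `F_μν = ∂_μ A_ν - ∂_ν A_μ + g [A_μ, A_ν]`. -/
def fieldStrength {N : ℕ} (g : ℝ) (A : Fin 3 → Space → Mat N) (μ ν : Fin 3) :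
    Space → Mat N :=
  fun x => partialD μ (A ν) x - partialD ν (A μ) x + g • ⁅A μ x, A ν x⁆

/-- The covariant derivative `D_μ φ = ∂_μ φ + g [A_μ, φ]`. -/
def covD {N : ℕ} (g : ℝ) (A : Fin 3 → Space → Mat N) (μ : Fin 3) (φ : Space → Mat N) :
    Space → Mat N :=
  fun x => partialD μ φ x + g • ⁅A μ x, φ x⁆

/-- Local covariant tensors built only with the field strength `F` and the covariant
derivative `D`: formal expressions, with `r` free space-time indices, obtained from `F` by
finitely many covariant derivatives, commutators, real linear combinations, multiplications
by the invariant tensors `ε_μνρ` and `δ_μν`, contractions and rearrangements of indices. -/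
inductive CovTensor : ℕ → Type
  | F : CovTensor 2
  | D {r : ℕ} (X : CovTensor r) : CovTensor (r + 1)
  | bracket {r s : ℕ} (X : CovTensor r) (Y : CovTensor s) : CovTensor (r + s)
  | add {r : ℕ} (X Y : CovTensor r) : CovTensor r
  | smul {r : ℕ} (a : ℝ) (X : CovTensor r) : CovTensor r
  | eps {r : ℕ} (X : CovTensor r) : CovTensor (r + 3)
  | delta {r : ℕ} (X : CovTensor r) : CovTensor (r + 2)
  | contract {r : ℕ} (X : CovTensor (r + 2)) : CovTensor r
  | reindex {r s : ℕ} (e : Fin r ≃ Fin s) (X : CovTensor r) : CovTensor s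

/-- The component with indices `I` of a covariant tensor, evaluated on the gauge field `A`
with coupling constant `g`. -/
def CovTensor.eval {N : ℕ} (g : ℝ) (A : Fin 3 → Space → Mat N) :
    {r : ℕ} → CovTensor r → (Fin r → Fin 3) → Space → Mat N
  | _, .F, I => fieldStrength g A (I 0) (I 1)
  | _, .D X, I => covD g A (I 0) (X.eval g A fun k => I k.succ)
  | _, .bracket (r := r) (s := s) X Y, I => fun x =>
      ⁅X.eval g A (fun k => I (Fin.castAdd s k)) x, Y.eval g A (fun k => I (Fin.natAdd r k)) x⁆
  | _, .add X Y, I => fun x => X.eval g A I x + Y.eval g A I x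
  | _, .smul a X, I => fun x => a • X.eval g A I x
  | _, .eps X, I => fun x =>
      leviCivita (I 0) (I 1) (I 2) • X.eval g A (fun k => I k.succ.succ.succ) x
  | _, .delta X, I => fun x =>
      if I 0 = I 1 then X.eval g A (fun k => I k.succ.succ) x else 0
  | _, .contract X, I => fun x => ∑ a : Fin 3, X.eval g A (Fin.cons a (Fin.cons a I)) x
  | _, .reindex e X, I => X.eval g A fun k => I (e k)

/-- The component `μ` of a covariant vector, evaluated on `A`. -/
def CovTensor.vec {N : ℕ} (g : ℝ) (A : Fin 3 → Space → Mat N) (X : CovTensor 1) (μ : Fin 3) :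
    Space → Mat N :=
  X.eval g A fun _ => μ

/-- `ϑ¹_μ = (1/4) ε_μστ F^στ`. -/
def theta1 {N : ℕ} (g : ℝ) (A : Fin 3 → Space → Mat N) (μ : Fin 3) : Space → Mat N :=
  fun x => (1 / 4 : ℝ) • ∑ σ, ∑ τ, leviCivita μ σ τ • fieldStrength g A σ τ x

/-- `ϑ²_μ = (1/8) D^σ F_σμ`. -/
def theta2 {N : ℕ} (g : ℝ) (A : Fin 3 → Space → Mat N) (μ : Fin 3) : Space → Mat N :=
  fun x => (1 / 8 : ℝ) • ∑ σ, covD g A σ (fieldStrength g A σ μ) x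

/-- `ϑ³_μ = -(1/16) ε_μστ D^σ D_ρ F^ρτ + (g/48) ε_μστ [F^σρ, F_ρ^τ]`. -/
def theta3 {N : ℕ} (g : ℝ) (A : Fin 3 → Space → Mat N) (μ : Fin 3) : Space → Mat N :=
  fun x =>
    (-(1 / 16) : ℝ) • (∑ σ, ∑ τ, ∑ ρ,
      leviCivita μ σ τ • covD g A σ (covD g A ρ (fieldStrength g A ρ τ)) x) +
    (g / 48) • (∑ σ, ∑ τ, ∑ ρ,
      leviCivita μ σ τ • ⁅fieldStrength g A σ ρ x, fieldStrength g A ρ τ x⁆)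

/-- `ϑ⁴_μ = -(5/128) D² D^ρ F_ρμ + (5/128) D^ν D_μ D^λ F_λν
  - (7/192) g [D^ρ F_ρτ, F_μ^τ] - (1/48) g [D_ν F_μλ, F^λν]`. -/
def theta4 {N : ℕ} (g : ℝ) (A : Fin 3 → Space → Mat N) (μ : Fin 3) : Space → Mat N :=
  fun x =>
    (-(5 / 128) : ℝ) • (∑ ν, ∑ ρ,
      covD g A ν (covD g A ν (covD g A ρ (fieldStrength g A ρ μ))) x) +
    (5 / 128 : ℝ) • (∑ ν, ∑ l,
      covD g A ν (covD g A μ (covD g A l (fieldStrength g A l ν))) x) -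
    (7 / 192 * g) • (∑ ρ, ∑ τ,
      ⁅covD g A ρ (fieldStrength g A ρ τ) x, fieldStrength g A μ τ x⁆) -
    (1 / 48 * g) • (∑ ν, ∑ l,
      ⁅covD g A ν (fieldStrength g A μ l) x, fieldStrength g A l ν x⁆)

/-- The Chern-Simons action
`S_CS(A) = (1/2) tr ∫ d³x ε^μνρ (A_μ ∂_ν A_ρ + (2/3) g A_μ A_ν A_ρ)`. -/
def chernSimons {N : ℕ} (g : ℝ) (A : Fin 3 → Space → Mat N) : ℂ :=
  (1 / 2 : ℂ) * ∫ x, Matrix.trace (∑ μ, ∑ ν, ∑ ρ, leviCivita μ ν ρ •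
    (A μ x * partialD ν (A ρ) x + (2 / 3 * g) • (A μ x * A ν x * A ρ x)))

/-- The density `tr F_μν F^μν`. -/
def traceFF {N : ℕ} (g : ℝ) (A : Fin 3 → Space → Mat N) : Space → ℂ :=
  fun x => Matrix.trace (∑ μ, ∑ ν, fieldStrength g A μ ν x * fieldStrength g A μ ν x)

/-- Partial derivative, coefficient by coefficient, of a formal power series in `1/m` whose
coefficients are matrix valued functions. -/
def partialDSeries {N : ℕ} (μ : Fin 3) (φ : PowerSeries (Space → Mat N)) :
    PowerSeries (Space → Mat N) :=
  PowerSeries.mk fun n => partialD μ (PowerSeries.coeff n φ)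

/-- The matrix valued Chern-Simons density
`ε^μνρ (A_μ ∂_ν A_ρ + (2/3) g A_μ A_ν A_ρ)` of a field that is a formal power series in `1/m`;
products are products of power series. -/
def chernSimonsDensitySeries {N : ℕ} (g : ℝ) (A : Fin 3 → PowerSeries (Space → Mat N)) :
    PowerSeries (Space → Mat N) :=
  ∑ μ, ∑ ν, ∑ ρ, leviCivita μ ν ρ •
    (A μ * partialDSeries ν (A ρ) + (2 / 3 * g) • (A μ * A ν * A ρ))

/-- The Chern-Simons action of a field that is a formal power series in `1/m`: it is itself a
formal power series in `1/m`, integrated order by order. -/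
def chernSimonsSeries {N : ℕ} (g : ℝ) (A : Fin 3 → PowerSeries (Space → Mat N)) :
    PowerSeries ℂ :=
  PowerSeries.mk fun n => (1 / 2 : ℂ) *
    ∫ x, Matrix.trace (PowerSeries.coeff n (chernSimonsDensitySeries g A) x)

/-- The redefined field `Â_μ = A_μ + ∑_{n ≥ 1} m⁻ⁿ ϑⁿ_μ(D,F)`, a formal power series
in `1/m`. -/
def redefined {N : ℕ} (g : ℝ) (ϑ : ℕ → CovTensor 1) (A : Fin 3 → Space → Mat N) (μ : Fin 3) :
    PowerSeries (Space → Mat N) :=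
  PowerSeries.mk fun n => if n = 0 then A μ else (ϑ n).vec g A μ

end ChernSimonsYM

end

open ChernSimonsYM

noncomputable section

namespace ChernSimonsYM

open MeasureTheory LineDeriv

variable {N : ℕ}

theorem IsSchwartz.isSmooth {φ : Space → Mat N} (h : IsSchwartz φ) : IsSmooth φ := by
  intro i j
  obtain ⟨f, hf⟩ := h i j
  simpa only [← funext hf] using f.smooth ⊤

theorem isSchwartz_zero : IsSchwartz (0 : Space → Mat N) := fun _ _ => ⟨0, fun _ => rfl⟩

theorem IsSchwartz.add {φ ψ : Space → Mat N} (hφ : IsSchwartz φ) (hψ : IsSchwartz ψ) :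
    IsSchwartz (φ + ψ) := by
  intro i j
  obtain ⟨f, hf⟩ := hφ i j
  obtain ⟨f', hf'⟩ := hψ i j
  exact ⟨f + f', fun x => by simp [hf, hf']⟩

theorem IsSchwartz.smul (a : ℝ) {φ : Space → Mat N} (hφ : IsSchwartz φ) :
    IsSchwartz (a • φ) := by
  intro i j
  obtain ⟨f, hf⟩ := hφ i j
  exact ⟨a • f, fun x => by simp [hf]⟩

theorem IsSchwartz.mul {φ ψ : Space → Mat N} (hφ : IsSchwartz φ) (hψ : IsSchwartz ψ) :
    IsSchwartz (φ * ψ) := by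
  intro i j
  choose f hf using hφ
  choose f' hf' using hψ
  refine ⟨∑ k, SchwartzMap.pairing (ContinuousLinearMap.mul ℝ ℂ) (f i k) (f' k j), fun x => ?_⟩
  simp [Matrix.mul_apply, hf, hf']

theorem IsSchwartz.partialD (μ : Fin 3) {φ : Space → Mat N} (hφ : IsSchwartz φ) :
    IsSchwartz (partialD μ φ) := by
  intro i j
  obtain ⟨f, hf⟩ := hφ i j
  refine ⟨∂_{EuclideanSpace.single μ (1 : ℝ)} f, fun x => ?_⟩
  rw [SchwartzMap.lineDerivOp_apply_eq_fderiv]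
  simp only [ChernSimonsYM.partialD, Matrix.of_apply, ← funext hf]

theorem IsSchwartz.exists_trace {φ : Space → Mat N} (hφ : IsSchwartz φ) :
    ∃ f : 𝓢(Space, ℂ), ∀ x, f x = Matrix.trace (φ x) := by
  choose f hf using hφ
  exact ⟨∑ k, f k k, fun x => by simp [Matrix.trace, hf]⟩

theorem IsSchwartz.integrable_trace {φ : Space → Mat N} (hφ : IsSchwartz φ) :
    Integrable fun x => Matrix.trace (φ x) := by
  obtain ⟨f, hf⟩ := hφ.exists_trace
  simpa only [← funext hf] using f.integrable

theorem IsSmooth.differentiable {φ : Space → Mat N} (h : IsSmooth φ) (i j : Fin N) :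
    Differentiable ℝ fun x => φ x i j :=
  (h i j).differentiable (by simp)

theorem partialD_apply (μ : Fin 3) (φ : Space → Mat N) (x : Space) (i j : Fin N) :
    partialD μ φ x i j = fderiv ℝ (fun y => φ y i j) x (EuclideanSpace.single μ (1 : ℝ)) := rfl

theorem partialD_add (μ : Fin 3) {φ ψ : Space → Mat N} (hφ : IsSmooth φ) (hψ : IsSmooth ψ) :
    partialD μ (φ + ψ) = partialD μ φ + partialD μ ψ := by
  ext x i j
  simp only [partialD_apply, Pi.add_apply, Matrix.add_apply]
  rw [fderiv_fun_add (hφ.differentiable i j x) (hψ.differentiable i j x)]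
  rfl

theorem partialD_smul (μ : Fin 3) (a : ℝ) {φ : Space → Mat N} (hφ : IsSmooth φ) :
    partialD μ (a • φ) = a • partialD μ φ := by
  ext x i j
  simp only [partialD_apply, Pi.smul_apply, Matrix.smul_apply]
  rw [fderiv_fun_const_smul (hφ.differentiable i j x)]
  rfl

theorem partialD_mul (μ : Fin 3) {φ ψ : Space → Mat N} (hφ : IsSmooth φ) (hψ : IsSmooth ψ) :
    partialD μ (φ * ψ) = partialD μ φ * ψ + φ * partialD μ ψ := by
  ext x i j
  simp only [partialD_apply, Pi.add_apply, Matrix.add_apply, Pi.mul_apply, Matrix.mul_apply]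
  rw [fderiv_fun_sum fun k _ => (hφ.differentiable i k x).fun_mul (hψ.differentiable k j x),
    _root_.sum_apply, ← Finset.sum_add_distrib]
  refine Finset.sum_congr rfl fun k _ => ?_
  rw [fderiv_fun_mul (hφ.differentiable i k x) (hψ.differentiable k j x)]
  simp
  ring

theorem partialD_comm (μ ν : Fin 3) {φ : Space → Mat N} (hφ : IsSmooth φ) :
    partialD μ (partialD ν φ) = partialD ν (partialD μ φ) := by
  ext x i j
  simp only [partialD_apply]
  have h2 : DifferentiableAt ℝ (fderiv ℝ fun y => φ y i j) x :=
    (contDiff_infty_iff_fderiv.1 (hφ i j)).2.differentiable (by simp) x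
  have hs : IsSymmSndFDerivAt ℝ (fun y => φ y i j) x :=
    (hφ i j).contDiffAt.isSymmSndFDerivAt
      (by simpa using ENat.LEInfty.out)
  rw [fderiv_clm_apply h2 (differentiableAt_const _), fderiv_clm_apply h2 (differentiableAt_const _)]
  simpa using hs _ _

theorem integral_trace_partialD (μ : Fin 3) {φ : Space → Mat N} (hφ : IsSchwartz φ) :
    ∫ x, Matrix.trace (partialD μ φ x) = 0 := by
  choose f hf using hφ
  have h0 : ∀ h : 𝓢(Space, ℂ), ∫ x, (∂_{EuclideanSpace.single μ (1 : ℝ)} h : 𝓢(Space, ℂ)) x = 0 := by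
    intro h
    have := integral_bilinear_hasLineDerivAt_right_eq_neg_left_of_integrable (μ := volume)
      (B := ContinuousLinearMap.mul ℝ ℂ) (f := fun _ : Space => (1 : ℂ)) (f' := fun _ => 0)
      (g := h) (g' := (∂_{EuclideanSpace.single μ (1 : ℝ)} h : 𝓢(Space, ℂ)))
      (v := EuclideanSpace.single μ (1 : ℝ)) (by simp)
      (by simpa using SchwartzMap.integrable (∂_{EuclideanSpace.single μ (1 : ℝ)} h))
      (by simpa using h.integrable)
      (fun x _ => (hasFDerivAt_const (1 : ℂ) x).hasLineDerivAt _)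
      (fun x _ => by
        rw [SchwartzMap.lineDerivOp_apply_eq_fderiv]
        exact (h.hasFDerivAt x).hasLineDerivAt _)
    simpa using this
  rw [← h0 (∑ k, f k k)]
  congr 1
  ext x
  simp only [Matrix.trace, Matrix.diag, partialD_apply, ← funext (hf _ _), LineDeriv.lineDerivOp_sum,
    _root_.sum_apply, SchwartzMap.lineDerivOp_apply_eq_fderiv]

/-- The algebra of matrix valued functions with Schwartz entries. -/
def schwartzFields (N : ℕ) : NonUnitalSubalgebra ℝ (Space → Mat N) where
  carrier := {φ | IsSchwartz φ}
  add_mem' := IsSchwartz.add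
  zero_mem' := isSchwartz_zero
  mul_mem' := IsSchwartz.mul
  smul_mem' := fun a _ h => h.smul a

theorem isSmooth_coe (X : schwartzFields N) : IsSmooth (X : Space → Mat N) :=
  IsSchwartz.isSmooth X.2

/-- Partial derivatives of Schwartz fields. -/
def pd (μ : Fin 3) : schwartzFields N →ₗ[ℝ] schwartzFields N where
  toFun X := ⟨partialD μ X, IsSchwartz.partialD μ X.2⟩
  map_add' X Y := Subtype.ext (partialD_add μ (isSmooth_coe X) (isSmooth_coe Y))
  map_smul' a X := Subtype.ext (partialD_smul μ a (isSmooth_coe X))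

theorem pd_mul (μ : Fin 3) (X Y : schwartzFields N) :
    pd μ (X * Y) = pd μ X * Y + X * pd μ Y :=
  Subtype.ext (partialD_mul μ (isSmooth_coe X) (isSmooth_coe Y))

theorem pd_comm (μ ν : Fin 3) (X : schwartzFields N) : pd μ (pd ν X) = pd ν (pd μ X) :=
  Subtype.ext (partialD_comm μ ν (isSmooth_coe X))

/-- The integrated trace of a Schwartz field. -/
def intTr : schwartzFields N →ₗ[ℝ] ℂ where
  toFun X := ∫ x, Matrix.trace ((X : Space → Mat N) x)
  map_add' X Y := by
    rw [← integral_add X.2.integrable_trace Y.2.integrable_trace]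
    simp
  map_smul' a X := by
    rw [RingHom.id_apply, ← integral_smul]
    simp

theorem intTr_apply (X : schwartzFields N) :
    intTr X = ∫ x, Matrix.trace ((X : Space → Mat N) x) := rfl

theorem intTr_mul_comm (X Y : schwartzFields N) : intTr (X * Y) = intTr (Y * X) := by
  simp only [intTr_apply]
  congr 1
  ext x
  exact Matrix.trace_mul_comm _ _

theorem intTr_pd (μ : Fin 3) (X : schwartzFields N) : intTr (pd μ X) = 0 :=
  integral_trace_partialD μ X.2

end ChernSimonsYM

end

noncomputable section

namespace ChernSimonsYM

variable {N : ℕ}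

/-- The covariant derivative of Schwartz fields. -/
def cD (g : ℝ) (A : Fin 3 → schwartzFields N) (μ : Fin 3) :
    schwartzFields N →ₗ[ℝ] schwartzFields N :=
  pd μ + g • (LinearMap.mulLeft ℝ (A μ) - LinearMap.mulRight ℝ (A μ))

theorem cD_apply (g : ℝ) (A : Fin 3 → schwartzFields N) (μ : Fin 3) (X : schwartzFields N) :
    cD g A μ X = pd μ X + g • (A μ * X - X * A μ) := rfl

theorem intTr_mul_cycle (X Y Z : schwartzFields N) :
    intTr (X * (Y * Z)) = intTr (Y * (Z * X)) := by
  rw [intTr_mul_comm, mul_assoc]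

theorem intTr_cD_mul (g : ℝ) (A : Fin 3 → schwartzFields N) (μ : Fin 3)
    (X Y : schwartzFields N) : intTr (cD g A μ X * Y) = -intTr (X * cD g A μ Y) := by
  have h := intTr_pd μ (X * Y)
  rw [pd_mul, map_add] at h
  have h2 := intTr_mul_cycle (A μ) X Y
  simp only [cD_apply, add_mul, mul_add, sub_mul, mul_sub, smul_mul_assoc, mul_smul_comm, map_add,
    map_sub, map_smul, smul_sub, mul_assoc] at h ⊢
  rw [h2]
  linear_combination h

/-- The `L²` pairing of Schwartz vector fields. -/
def dot (X Y : Fin 3 → schwartzFields N) : ℂ := ∑ μ, intTr (X μ * Y μ)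

theorem dot_comm (X Y : Fin 3 → schwartzFields N) : dot X Y = dot Y X :=
  Finset.sum_congr rfl fun _ _ => intTr_mul_comm _ _

theorem add_dot (X Y Z : Fin 3 → schwartzFields N) : dot (X + Y) Z = dot X Z + dot Y Z := by
  simp [dot, add_mul, Finset.sum_add_distrib]

theorem smul_dot (a : ℝ) (X Y : Fin 3 → schwartzFields N) : dot (a • X) Y = a • dot X Y := by
  simp only [dot, Pi.smul_apply, smul_mul_assoc, map_smul, Finset.smul_sum]

theorem dot_add (X Y Z : Fin 3 → schwartzFields N) : dot X (Y + Z) = dot X Y + dot X Z := by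
  rw [dot_comm, add_dot, dot_comm Y, dot_comm Z]

theorem dot_smul (a : ℝ) (X Y : Fin 3 → schwartzFields N) : dot X (a • Y) = a • dot X Y := by
  rw [dot_comm, smul_dot, dot_comm]

/-- The vector `ε_μνρ T_νρ`. -/
def epsDual {V : Type*} [AddCommGroup V] [Module ℝ V] (T : Fin 3 → Fin 3 → V) (μ : Fin 3) : V :=
  ∑ ν, ∑ ρ, leviCivita μ ν ρ • T ν ρ

section epsDual

variable {V : Type*} [AddCommGroup V] [Module ℝ V] (T : Fin 3 → Fin 3 → V)

theorem epsDual_zero : epsDual T 0 = T 1 2 - T 2 1 := by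
  simp [epsDual, Fin.sum_univ_three, leviCivita]
  norm_num
  abel

theorem epsDual_one : epsDual T 1 = T 2 0 - T 0 2 := by
  simp [epsDual, Fin.sum_univ_three, leviCivita]
  norm_num
  abel

theorem epsDual_two : epsDual T 2 = T 0 1 - T 1 0 := by
  simp [epsDual, Fin.sum_univ_three, leviCivita]
  norm_num
  abel

end epsDual

/-- The cross product of matrix valued vector fields. -/
def cross (X Y : Fin 3 → schwartzFields N) : Fin 3 → schwartzFields N :=
  epsDual fun ν ρ => X ν * Y ρ

/-- The curl of a vector field. -/
def curl (X : Fin 3 → schwartzFields N) : Fin 3 → schwartzFields N :=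
  epsDual fun ν ρ => pd ν (X ρ)

/-- The covariant curl of a vector field. -/
def covCurl (g : ℝ) (A X : Fin 3 → schwartzFields N) : Fin 3 → schwartzFields N :=
  epsDual fun ν ρ => cD g A ν (X ρ)

/-- The field strength as a tensor of Schwartz fields. -/
def strength (g : ℝ) (A : Fin 3 → schwartzFields N) (μ ν : Fin 3) : schwartzFields N :=
  pd μ (A ν) - pd ν (A μ) + g • (A μ * A ν - A ν * A μ)

/-- The dual field strength `½ ε_μνρ F_νρ`. -/
def dualF (g : ℝ) (A : Fin 3 → schwartzFields N) : Fin 3 → schwartzFields N :=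
  (1 / 2 : ℝ) • epsDual (strength g A)

theorem Fin.forall_three {P : Fin 3 → Prop} (h0 : P 0) (h1 : P 1) (h2 : P 2) : ∀ μ, P μ := by
  intro μ
  fin_cases μ
  exacts [h0, h1, h2]

section
variable (g : ℝ) (A : Fin 3 → schwartzFields N)

theorem dualF_eq : dualF g A = curl A + g • cross A A := by
  funext μ
  revert μ
  apply Fin.forall_three <;>
  simp only [dualF, curl, cross, strength, Pi.add_apply, Pi.smul_apply, epsDual_zero, epsDual_one,
    epsDual_two] <;> module

theorem covCurl_eq (X : Fin 3 → schwartzFields N) :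
    covCurl g A X = curl X + g • (cross A X + cross X A) := by
  funext μ
  revert μ
  apply Fin.forall_three <;>
  simp only [covCurl, curl, cross, cD_apply, Pi.add_apply, Pi.smul_apply, epsDual_zero, epsDual_one,
    epsDual_two] <;> module

theorem covCurl_smul (a : ℝ) (X : Fin 3 → schwartzFields N) :
    covCurl g A (a • X) = a • covCurl g A X := by
  funext μ
  revert μ
  apply Fin.forall_three <;>
  simp only [covCurl, map_smul, Pi.smul_apply, epsDual_zero, epsDual_one,
    epsDual_two] <;> module

theorem covCurl_add (X Y : Fin 3 → schwartzFields N) :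
    covCurl g A (X + Y) = covCurl g A X + covCurl g A Y := by
  funext μ
  revert μ
  apply Fin.forall_three <;>
  simp only [covCurl, map_add, Pi.add_apply, epsDual_zero, epsDual_one,
    epsDual_two] <;> module

theorem cross_smul_left (a : ℝ) (X Y : Fin 3 → schwartzFields N) :
    cross (a • X) Y = a • cross X Y := by
  funext μ
  revert μ
  apply Fin.forall_three <;>
  simp only [cross, smul_mul_assoc, Pi.smul_apply, epsDual_zero, epsDual_one,
    epsDual_two] <;> module

theorem cross_smul_right (a : ℝ) (X Y : Fin 3 → schwartzFields N) :
    cross X (a • Y) = a • cross X Y := by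
  funext μ
  revert μ
  apply Fin.forall_three <;>
  simp only [cross, mul_smul_comm, Pi.smul_apply, epsDual_zero, epsDual_one,
    epsDual_two] <;> module

theorem cross_add_left (X Y Z : Fin 3 → schwartzFields N) :
    cross (X + Y) Z = cross X Z + cross Y Z := by
  funext μ
  revert μ
  apply Fin.forall_three <;>
  simp only [cross, add_mul, Pi.add_apply, epsDual_zero, epsDual_one,
    epsDual_two] <;> module

theorem cross_add_right (X Y Z : Fin 3 → schwartzFields N) :
    cross X (Y + Z) = cross X Y + cross X Z := by
  funext μ
  revert μ
  apply Fin.forall_three <;>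
  simp only [cross, mul_add, Pi.add_apply, epsDual_zero, epsDual_one,
    epsDual_two] <;> module

theorem dot_covCurl (X Y : Fin 3 → schwartzFields N) :
    dot (covCurl g A X) Y = dot X (covCurl g A Y) := by
  simp only [dot, covCurl, Fin.sum_univ_three, epsDual_zero, epsDual_one, epsDual_two, sub_mul,
    mul_sub, map_sub, intTr_cD_mul]
  ring

theorem curl_eq_covCurl (X : Fin 3 → schwartzFields N) : curl X = covCurl 0 A X := by
  simp [covCurl_eq]

theorem dot_curl (X Y : Fin 3 → schwartzFields N) : dot (curl X) Y = dot X (curl Y) := by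
  rw [curl_eq_covCurl 0, curl_eq_covCurl 0, dot_covCurl]

theorem dot_cross (X Y Z : Fin 3 → schwartzFields N) :
    dot (cross X Y) Z = dot X (cross Y Z) := by
  simp only [dot, cross, Fin.sum_univ_three, epsDual_zero, epsDual_one, epsDual_two, sub_mul,
    mul_sub, map_sub, mul_assoc]
  ring

theorem dot_cross_cycle (X Y Z : Fin 3 → schwartzFields N) :
    dot X (cross Y Z) = dot Y (cross Z X) := by
  rw [← dot_cross Y, dot_comm]

/-- Covariant divergence of the dual field strength: the Bianchi identity. -/
theorem sum_cD_dualF : ∑ μ, cD g A μ (dualF g A μ) = 0 := by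
  rw [dualF_eq]
  simp only [Fin.sum_univ_three, cD_apply, curl, cross, Pi.add_apply, Pi.smul_apply, epsDual_zero,
    epsDual_one, epsDual_two, map_add, map_sub, map_smul, pd_mul, pd_comm 1 0, pd_comm 2 0,
    pd_comm 2 1, mul_sub, sub_mul, mul_assoc]
  module

theorem strength_eq (μ ν : Fin 3) :
    strength g A μ ν = ∑ ρ, leviCivita μ ν ρ • dualF g A ρ := by
  revert μ ν
  refine Fin.forall_three ?_ ?_ ?_ <;> refine Fin.forall_three ?_ ?_ ?_ <;>
  simp only [dualF, strength, Pi.smul_apply, Fin.sum_univ_three, epsDual_zero, epsDual_one,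
    epsDual_two] <;> norm_num [leviCivita] <;> module

end

end ChernSimonsYM

end

noncomputable section

namespace ChernSimonsYM

variable {N : ℕ}

/-- Evaluation of covariant tensors on Schwartz gauge fields. -/
def CovTensor.evalS (g : ℝ) (A : Fin 3 → schwartzFields N) :
    {r : ℕ} → CovTensor r → (Fin r → Fin 3) → schwartzFields N
  | _, .F, I => strength g A (I 0) (I 1)
  | _, .D X, I => cD g A (I 0) (X.evalS g A fun k => I k.succ)
  | _, .bracket (r := r) (s := s) X Y, I =>
      X.evalS g A (fun k => I (Fin.castAdd s k)) * Y.evalS g A (fun k => I (Fin.natAdd r k)) -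
      Y.evalS g A (fun k => I (Fin.natAdd r k)) * X.evalS g A (fun k => I (Fin.castAdd s k))
  | _, .add X Y, I => X.evalS g A I + Y.evalS g A I
  | _, .smul a X, I => a • X.evalS g A I
  | _, .eps X, I =>
      leviCivita (I 0) (I 1) (I 2) • X.evalS g A (fun k => I k.succ.succ.succ)
  | _, .delta X, I =>
      if I 0 = I 1 then X.evalS g A (fun k => I k.succ.succ) else 0
  | _, .contract X, I => ∑ a : Fin 3, X.evalS g A (Fin.cons a (Fin.cons a I))
  | _, .reindex e X, I => X.evalS g A fun k => I (e k)

theorem coe_cD (g : ℝ) (A : Fin 3 → schwartzFields N) (μ : Fin 3) (X : schwartzFields N) :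
    (cD g A μ X : Space → Mat N) = covD g (fun ν => (A ν : Space → Mat N)) μ X := by
  rfl

theorem coe_strength (g : ℝ) (A : Fin 3 → schwartzFields N) (μ ν : Fin 3) :
    (strength g A μ ν : Space → Mat N) =
      fieldStrength g (fun ν => (A ν : Space → Mat N)) μ ν := by
  rfl

theorem CovTensor.coe_evalS (g : ℝ) (A : Fin 3 → schwartzFields N) {r : ℕ} (X : CovTensor r)
    (I : Fin r → Fin 3) :
    (X.evalS g A I : Space → Mat N) = X.eval g (fun μ => (A μ : Space → Mat N)) I := by
  induction X with
  | F => exact coe_strength g A _ _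
  | D X ih => rw [evalS, coe_cD, ih, eval]
  | bracket X Y ihX ihY => simp only [evalS, eval, ← ihX, ← ihY]; rfl
  | add X Y ihX ihY => simp only [evalS, eval, ← ihX, ← ihY]; rfl
  | smul a X ih => simp only [evalS, eval, ← ih]; rfl
  | eps X ih => simp only [evalS, eval, ← ih]; rfl
  | delta X ih =>
    simp only [evalS, eval, ← ih]
    split_ifs <;> rfl
  | contract X ih =>
    simp only [evalS, eval, ← ih]
    ext x
    simp
  | reindex e X ih => simp only [evalS, eval, ← ih]

/-- Peel off the first member of each of the two families of contracted slots. -/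
def peelSlots (s r : ℕ) :
    (Fin (s + 1) ⊕ Fin (s + 1)) ⊕ Fin r ≃ (Fin s ⊕ Fin s) ⊕ Fin (r + 2) where
  toFun := Sum.elim
    (Sum.elim (Fin.cases (.inr 0) fun k => .inl (.inl k))
      (Fin.cases (.inr 1) fun k => .inl (.inr k)))
    fun i => .inr i.succ.succ
  invFun := Sum.elim (Sum.elim (fun k => .inl (.inl k.succ)) fun k => .inl (.inr k.succ))
    (Fin.cases (.inl (.inl 0)) (Fin.cases (.inl (.inr 0)) .inr))
  left_inv := by
    rintro ((k | k) | k)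
    · induction k using Fin.cases <;> rfl
    · induction k using Fin.cases <;> rfl
    · rfl
  right_inv := by
    rintro ((k | k) | k)
    · rfl
    · rfl
    · induction k using Fin.cases with
      | zero => rfl
      | succ k => induction k using Fin.cases <;> rfl

/-- The first three slots and the remaining ones. -/
def firstThree (r : ℕ) : Fin (r + 3) ≃ Fin 3 ⊕ Fin r where
  toFun := Fin.cases (.inl 0) (Fin.cases (.inl 1) (Fin.cases (.inl 2) .inr))
  invFun := Sum.elim ![0, 1, 2] fun k => k.succ.succ.succ
  left_inv := by
    intro k
    induction k using Fin.cases with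
    | zero => rfl
    | succ k =>
      induction k using Fin.cases with
      | zero => rfl
      | succ k => induction k using Fin.cases <;> rfl
  right_inv := by
    rintro (k | k)
    · fin_cases k <;> rfl
    · rfl

theorem sum_fin_succ_arrow {M : Type*} [AddCommMonoid M] {r : ℕ}
    (f : (Fin (r + 1) → Fin 3) → M) : ∑ I, f I = ∑ I, ∑ a, f (Fin.cons a I) := by
  rw [← Fintype.sum_equiv (Fin.consEquiv fun _ => Fin 3) (fun p => f (Fin.cons p.1 p.2)) f
    fun _ => rfl, Fintype.sum_prod_type, Finset.sum_comm]

theorem sum_fin_add_arrow {M : Type*} [AddCommMonoid M] {r s : ℕ}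
    (f : (Fin (r + s) → Fin 3) → M) : ∑ I, f I = ∑ I, ∑ J, f (Fin.append I J) := by
  rw [← Fintype.sum_equiv (Fin.appendEquiv r s) (fun p => f (Fin.append p.1 p.2)) f
    fun _ => rfl, Fintype.sum_prod_type]

theorem sum_fin_two_arrow {M : Type*} [AddCommMonoid M] (f : (Fin 2 → Fin 3) → M) :
    ∑ I, f I = ∑ a, ∑ b, f ![a, b] := by
  rw [sum_fin_succ_arrow, sum_fin_succ_arrow, Fintype.sum_unique, Finset.sum_comm]
  refine Finset.sum_congr rfl fun a _ => Finset.sum_congr rfl fun b _ => congrArg f ?_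
  ext k : 1
  fin_cases k <;> rfl

theorem CovTensor.exists_contract (s : ℕ) : ∀ {k r : ℕ} (W : CovTensor k)
    (e : Fin k ≃ (Fin s ⊕ Fin s) ⊕ Fin r), ∃ Z : CovTensor r, ∀ (N : ℕ) (g : ℝ)
      (A : Fin 3 → schwartzFields N) (I : Fin r → Fin 3), Z.evalS g A I =
        ∑ J : Fin s → Fin 3, W.evalS g A fun i => Sum.elim (Sum.elim J J) I (e i) := by
  induction s with
  | zero =>
    intro k r W e
    refine ⟨W.reindex (e.trans (Equiv.emptySum _ _)), fun N g A I => ?_⟩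
    rw [Fintype.sum_unique, evalS]
    congr 1
    ext i : 1
    simp only [Equiv.trans_apply]
    rcases e i with (j | j) | j
    · exact j.elim0
    · exact j.elim0
    · rfl
  | succ s ih =>
    intro k r W e
    obtain ⟨Z, hZ⟩ := ih W (e.trans (peelSlots s r))
    refine ⟨Z.contract, fun N g A I => ?_⟩
    rw [evalS, sum_fin_succ_arrow, Finset.sum_comm]
    refine Finset.sum_congr rfl fun a _ => ?_
    rw [hZ]
    refine Finset.sum_congr rfl fun J _ => congrArg _ ?_
    ext i : 1
    simp only [Equiv.trans_apply]
    rcases e i with (j | j) | j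
    · induction j using Fin.cases <;> rfl
    · induction j using Fin.cases <;> rfl
    · rfl

/-- The covariant vector `ε_μνρ W_νρ`. -/
def CovTensor.epsDual (W : CovTensor 2) : CovTensor 1 :=
  .contract (.contract (r := 3) (.reindex (r := 2 + 3) (s := 1 + 2 + 2)
    ⟨![4, 0, 2, 1, 3], ![1, 3, 2, 4, 0], by decide, by decide⟩ (.eps W)))

/-- The components of a covariant vector evaluated on a Schwartz gauge field. -/
def CovTensor.vecS (g : ℝ) (A : Fin 3 → schwartzFields N) (X : CovTensor 1) (μ : Fin 3) :
    schwartzFields N :=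
  X.evalS g A fun _ => μ

theorem CovTensor.coe_vecS (g : ℝ) (A : Fin 3 → schwartzFields N) (X : CovTensor 1) (μ : Fin 3) :
    (X.vecS g A μ : Space → Mat N) = X.vec g (fun μ => (A μ : Space → Mat N)) μ :=
  X.coe_evalS g A _

theorem CovTensor.vecS_epsDual (g : ℝ) (A : Fin 3 → schwartzFields N) (W : CovTensor 2) :
    W.epsDual.vecS g A = ChernSimonsYM.epsDual fun ν ρ => W.evalS g A ![ν, ρ] := by
  funext μ
  simp only [vecS, CovTensor.epsDual, evalS, ChernSimonsYM.epsDual]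
  rw [Finset.sum_comm]
  refine Finset.sum_congr rfl fun ν _ => Finset.sum_congr rfl fun ρ _ => ?_
  congr 2
  ext k : 1
  fin_cases k <;> rfl

theorem CovTensor.exists_pairing (g : ℝ) {r : ℕ} (X : CovTensor r) :
    ∀ Y : CovTensor r, ∃ Z : CovTensor 1, ∀ (N : ℕ) (A : Fin 3 → schwartzFields N),
      ∑ I, intTr (X.evalS g A I * Y.evalS g A I) = dot (Z.vecS g A) (dualF g A) := by
  induction X with
  | F =>
    intro Y
    refine ⟨Y.epsDual, fun N A => ?_⟩
    have h0 : ∀ a, strength g A a a = 0 := fun a => by simp [strength]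
    have h1 : ∀ a b, strength g A a b = (-1 : ℝ) • strength g A b a := fun a b => by
      simp only [strength]
      module
    rw [dot_comm, sum_fin_two_arrow]
    simp only [vecS_epsDual, dot, Fin.sum_univ_three,
      epsDual_zero, epsDual_one, epsDual_two, evalS, dualF, Pi.smul_apply, Matrix.cons_val_zero,
      Matrix.cons_val_one, h0, h1 2 0, h1 1 0, h1 2 1, smul_mul_assoc, mul_sub, sub_mul, map_smul,
      map_sub, zero_mul, map_zero, Complex.real_smul]
    push_cast
    ring
  | @D r X ih =>
    intro Y
    obtain ⟨Z, hZ⟩ := ih (.smul (-1) (.contract (.D Y)))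
    refine ⟨Z, fun N A => ?_⟩
    rw [← hZ, sum_fin_succ_arrow]
    refine Finset.sum_congr rfl fun I _ => ?_
    simp only [evalS, Fin.cons_zero, Fin.cons_succ, intTr_cD_mul, mul_smul_comm, Finset.mul_sum,
      map_smul, map_sum, Finset.smul_sum]
    simp
  | @bracket r s X₁ X₂ ih _ =>
    intro Y
    obtain ⟨Y', hY'⟩ := exists_contract s (r := r) (.bracket X₂ Y)
      (finSumFinEquiv.symm.trans (((Equiv.refl _).sumCongr
        (finSumFinEquiv.symm.trans (Equiv.sumComm _ _))).trans (Equiv.sumAssoc _ _ _).symm))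
    obtain ⟨Z, hZ⟩ := ih Y'
    refine ⟨Z, fun N A => ?_⟩
    rw [← hZ, sum_fin_add_arrow]
    refine Finset.sum_congr rfl fun I _ => ?_
    rw [hY', Finset.mul_sum, map_sum]
    refine Finset.sum_congr rfl fun J _ => ?_
    have e₁ : ∀ k, Sum.elim (Sum.elim J J) I
        ((finSumFinEquiv.symm.trans (((Equiv.refl _).sumCongr (finSumFinEquiv.symm.trans
          (Equiv.sumComm _ _))).trans (Equiv.sumAssoc _ _ _).symm)) (Fin.castAdd (r + s) k)) =
        J k := fun k => by simp
    have e₂ : ∀ k, Sum.elim (Sum.elim J J) I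
        ((finSumFinEquiv.symm.trans (((Equiv.refl _).sumCongr (finSumFinEquiv.symm.trans
          (Equiv.sumComm _ _))).trans (Equiv.sumAssoc _ _ _).symm)) (Fin.natAdd s k)) =
        Fin.append I J k := fun k => by
      induction k using Fin.addCases <;> simp
    simp only [evalS, Fin.append_left, Fin.append_right, sub_mul, mul_sub, map_sub, mul_assoc, e₁,
      e₂]
    rw [intTr_mul_cycle (X₂.evalS g A _) (X₁.evalS g A _)]
  | add X₁ X₂ ih₁ ih₂ =>
    intro Y
    obtain ⟨Z₁, h₁⟩ := ih₁ Y
    obtain ⟨Z₂, h₂⟩ := ih₂ Y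
    refine ⟨.add Z₁ Z₂, fun N A => ?_⟩
    have : (CovTensor.add Z₁ Z₂).vecS g A = Z₁.vecS g A + Z₂.vecS g A := rfl
    rw [this, add_dot, ← h₁, ← h₂, ← Finset.sum_add_distrib]
    simp only [evalS, add_mul, map_add]
  | smul a X ih =>
    intro Y
    obtain ⟨Z, hZ⟩ := ih Y
    refine ⟨.smul a Z, fun N A => ?_⟩
    have : (CovTensor.smul a Z).vecS g A = a • Z.vecS g A := rfl
    rw [this, smul_dot, ← hZ, Finset.smul_sum]
    simp only [evalS, smul_mul_assoc, map_smul]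
  | @eps r X ih =>
    intro Y
    obtain ⟨Y', hY'⟩ := exists_contract 3 (r := r) (.eps Y)
      ((firstThree _).trans (((Equiv.refl _).sumCongr (firstThree r)).trans
        (Equiv.sumAssoc _ _ _).symm))
    obtain ⟨Z, hZ⟩ := ih Y'
    refine ⟨Z, fun N A => ?_⟩
    rw [← hZ]
    simp only [hY', sum_fin_succ_arrow (r := r), sum_fin_succ_arrow (r := r + 1),
      sum_fin_succ_arrow (r := r + 2), sum_fin_succ_arrow (r := 0), sum_fin_succ_arrow (r := 1),
      sum_fin_succ_arrow (r := 2), Fintype.sum_unique, Finset.mul_sum, map_sum]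
    refine Finset.sum_congr rfl fun I _ => Finset.sum_congr rfl fun a _ =>
      Finset.sum_congr rfl fun b _ => Finset.sum_congr rfl fun c _ => ?_
    simp only [evalS, smul_mul_assoc, mul_smul_comm]
    congr 4
    · rfl
    ext k : 1
    induction k using Fin.cases with
    | zero => rfl
    | succ k =>
      induction k using Fin.cases with
      | zero => rfl
      | succ k => induction k using Fin.cases <;> rfl
  | @delta r X ih =>
    intro Y
    obtain ⟨Z, hZ⟩ := ih (.contract Y)
    refine ⟨Z, fun N A => ?_⟩
    rw [← hZ, sum_fin_succ_arrow, sum_fin_succ_arrow]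
    refine Finset.sum_congr rfl fun I _ => ?_
    simp only [evalS, Fin.cons_zero, Fin.cons_one, Fin.cons_succ, Finset.mul_sum, map_sum]
    refine Finset.sum_congr rfl fun a _ => ?_
    rw [Finset.sum_eq_single a (fun b _ hb => by rw [if_neg hb, zero_mul, map_zero]) (by simp),
      if_pos rfl]
  | @contract r X ih =>
    intro Y
    obtain ⟨Z, hZ⟩ := ih (.delta Y)
    refine ⟨Z, fun N A => ?_⟩
    rw [← hZ, sum_fin_succ_arrow, sum_fin_succ_arrow]
    refine Finset.sum_congr rfl fun I _ => ?_
    simp only [evalS, Fin.cons_zero, Fin.cons_one, Fin.cons_succ, Finset.sum_mul, map_sum]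
    refine Finset.sum_congr rfl fun a _ => ?_
    rw [Finset.sum_eq_single a (fun b _ hb => by rw [if_neg hb, mul_zero, map_zero]) (by simp),
      if_pos rfl]
  | @reindex r s e X ih =>
    intro Y
    obtain ⟨Z, hZ⟩ := ih (.reindex e.symm Y)
    refine ⟨Z, fun N A => ?_⟩
    rw [← hZ]
    refine Fintype.sum_equiv (e.symm.arrowCongr (Equiv.refl _)) _ _ fun I => ?_
    simp only [evalS]
    congr 3
    ext k : 1
    simp

end ChernSimonsYM

end

noncomputable section

namespace ChernSimonsYM

variable {N : ℕ}

/-- Coefficients of the product, with respect to a bilinear map, of two formal power series. -/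
def conv {U V W : Type*} [AddCommGroup U] [AddCommGroup V] [AddCommGroup W] [Module ℝ U]
    [Module ℝ V] [Module ℝ W] (f : U →ₗ[ℝ] V →ₗ[ℝ] W) (u : ℕ → U) (v : ℕ → V) (n : ℕ) : W :=
  ∑ p ∈ Finset.HasAntidiagonal.antidiagonal n, f (u p.1) (v p.2)

section conv

variable {U V W : Type*} [AddCommGroup U] [AddCommGroup V] [AddCommGroup W] [Module ℝ U]
    [Module ℝ V] [Module ℝ W] (f : U →ₗ[ℝ] V →ₗ[ℝ] W)

theorem conv_add_left (u u' : ℕ → U) (v : ℕ → V) :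
    conv f (u + u') v = conv f u v + conv f u' v := by
  funext n
  simp [conv, Finset.sum_add_distrib]

theorem conv_add_right (u : ℕ → U) (v v' : ℕ → V) :
    conv f u (v + v') = conv f u v + conv f u v' := by
  funext n
  simp [conv, Finset.sum_add_distrib]

theorem conv_single_left (a : U) (v : ℕ → V) :
    conv f (Pi.single 0 a) v = fun n => f a (v n) := by
  funext n
  rw [conv, Finset.sum_eq_single (0, n)]
  · simp
  · rintro ⟨i, j⟩ hp hne
    rcases Nat.eq_zero_or_pos i with rfl | hi
    · simp_all
    · simp [hi.ne']
  · simp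

theorem conv_single_right (u : ℕ → U) (b : V) :
    conv f u (Pi.single 0 b) = fun n => f (u n) b := by
  funext n
  rw [conv, Finset.sum_eq_single (n, 0)]
  · simp
  · rintro ⟨i, j⟩ hp hne
    rcases Nat.eq_zero_or_pos j with rfl | hj
    · simp_all
    · simp [hj.ne']
  · simp

end conv

/-- `dot` as a bilinear map. -/
def dotL : (Fin 3 → schwartzFields N) →ₗ[ℝ] (Fin 3 → schwartzFields N) →ₗ[ℝ] ℂ :=
  LinearMap.mk₂ ℝ dot add_dot smul_dot dot_add dot_smul

/-- `cross` as a bilinear map. -/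
def crossL : (Fin 3 → schwartzFields N) →ₗ[ℝ] (Fin 3 → schwartzFields N) →ₗ[ℝ]
    (Fin 3 → schwartzFields N) :=
  LinearMap.mk₂ ℝ cross cross_add_left cross_smul_left cross_add_right cross_smul_right

/-- `covCurl` as a linear map. -/
def covCurlL (g : ℝ) (A : Fin 3 → schwartzFields N) :
    (Fin 3 → schwartzFields N) →ₗ[ℝ] (Fin 3 → schwartzFields N) where
  toFun := covCurl g A
  map_add' := covCurl_add g A
  map_smul' := covCurl_smul g A

theorem dotL_apply (X Y : Fin 3 → schwartzFields N) : dotL X Y = dot X Y := rfl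

theorem crossL_apply (X Y : Fin 3 → schwartzFields N) : crossL X Y = cross X Y := rfl

theorem covCurlL_apply (g : ℝ) (A X : Fin 3 → schwartzFields N) :
    covCurlL g A X = covCurl g A X := rfl

/-- The coefficients of the Chern-Simons density of a formal power series of fields. -/
def densityCoeff (g : ℝ) (a : ℕ → Fin 3 → schwartzFields N) (n : ℕ) : schwartzFields N :=
  ∑ μ, epsDual (fun ν ρ =>
    (∑ p ∈ Finset.HasAntidiagonal.antidiagonal n, a p.1 μ * pd ν (a p.2 ρ) +
      (2 / 3 * g) • ∑ p ∈ Finset.HasAntidiagonal.antidiagonal n,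
        (∑ q ∈ Finset.HasAntidiagonal.antidiagonal p.1, a q.1 μ * a q.2 ν) * a p.2 ρ)) μ

theorem intTr_densityCoeff (g : ℝ) (a : ℕ → Fin 3 → schwartzFields N) (n : ℕ) :
    intTr (densityCoeff g a n) =
      conv (dotL.compl₂ (covCurlL 0 0)) a a n +
      (2 / 3 * g) • conv dotL (conv crossL a a) a n := by
  simp only [densityCoeff, Fin.sum_univ_three, epsDual_zero, epsDual_one,
    epsDual_two, conv, LinearMap.compl₂_apply, dotL_apply, crossL_apply, covCurlL_apply, dot,
    ← curl_eq_covCurl, curl, cross, LinearMap.sum_apply, Finset.sum_sub_distrib,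
    Finset.sum_add_distrib, map_add, map_sub,
    mul_sub, sub_mul, map_smul, map_sum, mul_assoc, smul_sub, smul_add, Finset.sum_mul]
  simp only [Complex.real_smul]
  ring

/-- The part of order `n` of the Chern-Simons action, relative to the background field `A`, that
does not involve the coefficient of order `n` itself. -/
def remainder (g : ℝ) (A : Fin 3 → schwartzFields N) (a : ℕ → Fin 3 → schwartzFields N) (n : ℕ) :
    ℂ :=
  conv (dotL.compl₂ (covCurlL g A)) a a n + (2 / 3 * g) • conv dotL (conv crossL a a) a n

theorem intTr_densityCoeff_of_pos (g : ℝ) (A : Fin 3 → schwartzFields N)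
    (a : ℕ → Fin 3 → schwartzFields N) {n : ℕ} (hn : n ≠ 0) :
    intTr (densityCoeff g (Pi.single 0 A + a) n) =
      (2 : ℝ) • dot (a n) (dualF g A) + remainder g A a n := by
  have h1 : conv (dotL.compl₂ (covCurlL g A)) a a n = conv (dotL.compl₂ (covCurlL 0 0)) a a n +
      g • (conv dotL (fun n => cross (a n) A) a n + conv dotL (fun n => cross A (a n)) a n) := by
    simp only [conv, ← Finset.sum_add_distrib, Finset.smul_sum]
    refine Finset.sum_congr rfl fun p _ => ?_
    simp only [LinearMap.compl₂_apply, dotL_apply, covCurlL_apply, ← curl_eq_covCurl]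
    rw [covCurl_eq, dot_add, dot_smul, dot_add, dot_cross (a p.1), dot_cross_cycle (a p.1) (a p.2),
      dot_comm (a p.2)]
  have h2 : conv dotL (fun n => cross A (a n)) a n = dot (conv crossL a a n) A := by
    rw [← dotL_apply, conv, conv, map_sum, LinearMap.sum_apply]
    refine Finset.sum_congr rfl fun p _ => ?_
    rw [dotL_apply, dotL_apply, crossL_apply, dot_cross, dot_comm]
  have h3 : conv dotL (fun n => cross (a n) A) a n = dot (conv crossL a a n) A := by
    rw [← dotL_apply, conv, conv, map_sum, LinearMap.sum_apply, ← Finset.Nat.sum_antidiagonal_swap]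
    refine Finset.sum_congr rfl fun p _ => ?_
    rw [dotL_apply, dotL_apply, crossL_apply, dot_cross, dot_cross_cycle, dot_comm]
    rfl
  have hs : (fun n => cross ((Pi.single 0 A + a : ℕ → Fin 3 → schwartzFields N) n) A) =
      Pi.single 0 (cross A A) + fun n => cross (a n) A := by
    funext n
    rw [Pi.add_apply, Pi.add_apply, cross_add_left]
    congr 1
    rcases Nat.eq_zero_or_pos n with rfl | h
    · simp
    · rw [Pi.single_eq_of_ne h.ne', Pi.single_eq_of_ne h.ne', ← crossL_apply, map_zero]
      rfl
  have hc : conv crossL (Pi.single 0 A + a) (Pi.single 0 A + a) = Pi.single 0 (cross A A) +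
      (fun n => cross (a n) A) + ((fun n => cross A (a n)) + conv crossL a a) := by
    simp only [conv_add_left, conv_add_right, conv_single_left, conv_single_right, crossL_apply, hs]
  have hA : dot (cross A (a n)) A = dot (a n) (cross A A) := by
    rw [dot_comm, dot_cross_cycle, dot_cross_cycle]
  have hA' : dot (cross (a n) A) A = dot (a n) (cross A A) := by
    rw [dot_cross]
  have hd : dot A (curl (a n)) = dot (a n) (curl A) := by
    rw [← dot_curl, dot_comm]
  have h0 (X : Fin 3 → schwartzFields N) : dot 0 X = 0 := by rw [← dotL_apply, map_zero]; rfl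
  rw [intTr_densityCoeff, remainder, h1, h2, h3, dualF_eq, hc]
  simp only [conv_add_left, conv_add_right, conv_single_left, conv_single_right, Pi.add_apply,
    Pi.single_eq_of_ne hn, dotL_apply, covCurlL_apply, LinearMap.compl₂_apply, add_dot,
    dot_add, ← curl_eq_covCurl, h2, h3, hA, hA', hd, dot_smul, h0, zero_add]
  rw [dot_comm (cross A A)]
  simp only [Complex.real_smul]
  push_cast
  ring

end ChernSimonsYM

end

noncomputable section

namespace ChernSimonsYM

variable {N : ℕ}

namespace CovTensor

/-- The tensor with components `∑ρ X_σρρτ`. -/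
def contractMiddle (X : CovTensor 4) : CovTensor 2 :=
  .contract (.reindex (s := 4) ⟨![2, 0, 1, 3], ![1, 2, 0, 3], by decide, by decide⟩ X)

/-- The coefficient of order one. -/
def coeff₁ : CovTensor 1 := .smul (1 / 4) (.epsDual .F)

/-- The coefficient of order two. -/
def coeff₂ : CovTensor 1 := .smul (1 / 8) (.contract (.D .F))

/-- The coefficient of order three. -/
def coeff₃ (g : ℝ) : CovTensor 1 :=
  .add (.smul (-(1 / 16)) (.epsDual (contractMiddle (.D (.D .F)))))
    (.smul (g / 48) (.epsDual (contractMiddle (.bracket (r := 2) (s := 2) .F .F))))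

/-- The vector with components `∑ν ∑l X_νlμ` after distributing the slots of `X` by `e`. -/
def contractTwo (e : Fin 5 ≃ Fin 5) (X : CovTensor 5) : CovTensor 1 :=
  .contract (.contract (r := 3) (.reindex e X))

/-- The coefficient of order four. -/
def coeff₄ (g : ℝ) : CovTensor 1 :=
  .add (.add (.add
    (.smul (-(5 / 128)) (contractTwo
      ⟨![2, 3, 0, 1, 4], ![2, 3, 0, 1, 4], by decide, by decide⟩ (.D (.D (.D .F)))))
    (.smul (5 / 128) (contractTwo
      ⟨![2, 4, 0, 1, 3], ![2, 3, 0, 4, 1], by decide, by decide⟩ (.D (.D (.D .F))))))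
    (.smul (-(7 / 192 * g)) (contractTwo
      ⟨![2, 3, 0, 4, 1], ![2, 4, 0, 1, 3], by decide, by decide⟩
      (.bracket (r := 3) (s := 2) (.D .F) .F))))
    (.smul (-(1 / 48 * g)) (contractTwo
      ⟨![2, 4, 0, 1, 3], ![2, 3, 0, 4, 1], by decide, by decide⟩
      (.bracket (r := 3) (s := 2) (.D .F) .F)))

theorem vec_epsDual (g : ℝ) (A : Fin 3 → Space → Mat N) (W : CovTensor 2) (μ : Fin 3)
    (x : Space) :
    W.epsDual.vec g A μ x = ∑ ν, ∑ ρ, leviCivita μ ν ρ • W.eval g A ![ν, ρ] x := by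
  simp only [vec, CovTensor.epsDual, eval]
  rw [Finset.sum_comm]
  refine Finset.sum_congr rfl fun ν _ => Finset.sum_congr rfl fun ρ _ => ?_
  refine congrArg (fun J => leviCivita μ ν ρ • W.eval g A J x) ?_
  ext k : 1
  fin_cases k <;> rfl

variable (g : ℝ) (A : Fin 3 → Space → Mat N) (μ : Fin 3)

theorem vec_coeff₁ : coeff₁.vec g A μ = theta1 g A μ := by
  funext x
  have : coeff₁.vec g A μ x = (1 / 4 : ℝ) • (CovTensor.F.epsDual).vec g A μ x := rfl
  rw [this, vec_epsDual]
  rfl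

theorem vec_coeff₂ : coeff₂.vec g A μ = theta2 g A μ := rfl

theorem vec_coeff₃ : (coeff₃ g).vec g A μ = theta3 g A μ := by
  funext x
  have : (coeff₃ g).vec g A μ x =
      (-(1 / 16) : ℝ) • (CovTensor.epsDual (contractMiddle (.D (.D .F)))).vec g A μ x +
      (g / 48) • (CovTensor.epsDual (contractMiddle
        (.bracket (r := 2) (s := 2) .F .F))).vec g A μ x := rfl
  rw [this, vec_epsDual, vec_epsDual, theta3]
  simp only [← Finset.smul_sum]
  rfl

theorem vec_coeff₄ : (coeff₄ g).vec g A μ = theta4 g A μ := by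
  funext x
  simp only [theta4, sub_eq_add_neg, ← neg_smul]
  rfl

end CovTensor

section

variable (g : ℝ) (A : Fin 3 → schwartzFields N)

theorem strength_self (μ : Fin 3) : strength g A μ μ = 0 := by
  simp [strength]

theorem strength_zero_one : strength g A 0 1 = dualF g A 2 := by
  norm_num [strength_eq, Fin.sum_univ_three, leviCivita]

theorem strength_one_two : strength g A 1 2 = dualF g A 0 := by
  norm_num [strength_eq, Fin.sum_univ_three, leviCivita]

theorem strength_two_zero : strength g A 2 0 = dualF g A 1 := by
  norm_num [strength_eq, Fin.sum_univ_three, leviCivita]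

theorem strength_swap (μ ν : Fin 3) : strength g A μ ν = -(1 : ℝ) • strength g A ν μ := by
  simp only [strength]
  module

theorem strength_one_zero : strength g A 1 0 = -(1 : ℝ) • dualF g A 2 := by
  rw [strength_swap, strength_zero_one]

theorem strength_two_one : strength g A 2 1 = -(1 : ℝ) • dualF g A 0 := by
  rw [strength_swap, strength_one_two]

theorem strength_zero_two : strength g A 0 2 = -(1 : ℝ) • dualF g A 1 := by
  rw [strength_swap, strength_two_zero]

theorem sum_cD_strength (μ : Fin 3) :
    ∑ σ, cD g A σ (strength g A σ μ) = -(1 : ℝ) • covCurl g A (dualF g A) μ := by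
  revert μ
  apply Fin.forall_three <;>
  simp only [covCurl, Fin.sum_univ_three, epsDual_zero, epsDual_one, epsDual_two, strength_self, strength_zero_one, strength_one_two,
    strength_two_zero, strength_one_zero, strength_two_one, strength_zero_two, map_smul, map_zero] <;>
  module

theorem covCurl_covCurl (X : Fin 3 → schwartzFields N) (μ : Fin 3) :
    covCurl g A (covCurl g A X) μ =
      ∑ ν, cD g A ν (cD g A μ (X ν)) - ∑ ν, cD g A ν (cD g A ν (X μ)) := by
  revert μ
  apply Fin.forall_three <;>
  simp only [covCurl, Fin.sum_univ_three, epsDual_zero, epsDual_one, epsDual_two, map_sub] <;>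
  module

theorem vecS_coeff₁ : CovTensor.coeff₁.vecS g A = (1 / 2 : ℝ) • dualF g A := by
  have : CovTensor.coeff₁.vecS g A = (1 / 4 : ℝ) • (CovTensor.F.epsDual).vecS g A := rfl
  rw [this, CovTensor.vecS_epsDual]
  have : (epsDual fun ν ρ => CovTensor.F.evalS g A ![ν, ρ]) = (2 : ℝ) • dualF g A := by
    rw [dualF, smul_smul]
    norm_num
    rfl
  rw [this, smul_smul]
  norm_num

theorem vecS_coeff₂ :
    CovTensor.coeff₂.vecS g A = -(1 / 8 : ℝ) • covCurl g A (dualF g A) := by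
  funext μ
  have : CovTensor.coeff₂.vecS g A μ = (1 / 8 : ℝ) • ∑ σ, cD g A σ (strength g A σ μ) := rfl
  rw [this, sum_cD_strength, Pi.smul_apply]
  module

theorem vecS_coeff₃ :
    (CovTensor.coeff₃ g).vecS g A = (1 / 16 : ℝ) • covCurl g A (covCurl g A (dualF g A)) +
      (-(g / 24)) • cross (dualF g A) (dualF g A) := by
  have h : (CovTensor.coeff₃ g).vecS g A =
      (-(1 / 16) : ℝ) • (CovTensor.epsDual (.contractMiddle (.D (.D .F)))).vecS g A +
      (g / 48) • (CovTensor.epsDual (.contractMiddle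
        (.bracket (r := 2) (s := 2) .F .F))).vecS g A := rfl
  have h1 : (fun ν ρ => (CovTensor.contractMiddle (.D (.D .F))).evalS g A ![ν, ρ]) =
      fun ν ρ => -(1 : ℝ) • cD g A ν (covCurl g A (dualF g A) ρ) := by
    funext ν ρ
    rw [← map_smul, ← sum_cD_strength, map_sum]
    rfl
  have h2 : (fun ν ρ => (CovTensor.contractMiddle
      (.bracket (r := 2) (s := 2) .F .F)).evalS g A ![ν, ρ]) =
      fun ν ρ => ∑ σ, (strength g A ν σ * strength g A σ ρ -
        strength g A σ ρ * strength g A ν σ) := rfl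
  rw [h, CovTensor.vecS_epsDual, CovTensor.vecS_epsDual, h1, h2]
  funext μ
  revert μ
  apply Fin.forall_three <;>
  simp only [covCurl, cross, Pi.smul_apply, Pi.add_apply,
    Fin.sum_univ_three, epsDual_zero, epsDual_one, epsDual_two, strength_self, strength_zero_one, strength_one_two,
    strength_two_zero, strength_one_zero, strength_two_one, strength_zero_two,
    smul_mul_assoc, mul_smul_comm, zero_mul, mul_zero] <;>
  module

theorem sum_commutator_divergence_strength (μ : Fin 3) :
    ∑ ρ, ∑ τ, (cD g A ρ (strength g A ρ τ) * strength g A μ τ -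
        strength g A μ τ * cD g A ρ (strength g A ρ τ)) = -(1 : ℝ) •
      (cross (covCurl g A (dualF g A)) (dualF g A) +
        cross (dualF g A) (covCurl g A (dualF g A))) μ := by
  rw [Finset.sum_comm]
  simp only [Finset.sum_sub_distrib, ← Finset.sum_mul, ← Finset.mul_sum, sum_cD_strength]
  revert μ
  apply Fin.forall_three <;>
  simp only [cross, Pi.add_apply,
    Fin.sum_univ_three, epsDual_zero, epsDual_one, epsDual_two,
    strength_self, strength_zero_one, strength_one_two, strength_two_zero, strength_one_zero,
    strength_two_one, strength_zero_two,
    smul_mul_assoc, mul_smul_comm, zero_mul, mul_zero] <;>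
  module

theorem sum_commutator_cD_strength (μ : Fin 3) :
    ∑ ν, ∑ l, (cD g A ν (strength g A μ l) * strength g A l ν -
        strength g A l ν * cD g A ν (strength g A μ l)) = -(1 : ℝ) •
      ∑ ν, (cD g A μ (dualF g A ν) * dualF g A ν -
        dualF g A ν * cD g A μ (dualF g A ν)) := by
  have hb := sum_cD_dualF g A
  rw [Fin.sum_univ_three] at hb
  have hb' : cD g A 0 (dualF g A 0) = -(1 : ℝ) • cD g A 1 (dualF g A 1) +
      -(1 : ℝ) • cD g A 2 (dualF g A 2) := by
    rw [add_assoc] at hb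
    rw [eq_neg_of_add_eq_zero_left hb]
    module
  revert μ
  apply Fin.forall_three <;>
  simp only [Fin.sum_univ_three, hb', add_mul, mul_add,
    strength_self, strength_zero_one, strength_one_two, strength_two_zero, strength_one_zero,
    strength_two_one, strength_zero_two, map_smul, map_zero,
    smul_mul_assoc, mul_smul_comm, zero_mul, mul_zero] <;>
  module

theorem vecS_coeff₄ :
    (CovTensor.coeff₄ g).vecS g A =
      (-(5 / 128) : ℝ) • covCurl g A (covCurl g A (covCurl g A (dualF g A))) +
      (7 / 192 * g) • (cross (covCurl g A (dualF g A)) (dualF g A) +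
        cross (dualF g A) (covCurl g A (dualF g A))) +
      (1 / 48 * g) • (fun μ => ∑ ν, (cD g A μ (dualF g A ν) * dualF g A ν -
        dualF g A ν * cD g A μ (dualF g A ν))) := by
  have h : (CovTensor.coeff₄ g).vecS g A = fun μ =>
      (-(5 / 128) : ℝ) • (∑ ν, ∑ ρ, cD g A ν (cD g A ν (cD g A ρ (strength g A ρ μ)))) +
      (5 / 128 : ℝ) • (∑ ν, ∑ l, cD g A ν (cD g A μ (cD g A l (strength g A l ν)))) +
      (-(7 / 192 * g)) • (∑ ρ, ∑ τ, (cD g A ρ (strength g A ρ τ) * strength g A μ τ -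
        strength g A μ τ * cD g A ρ (strength g A ρ τ))) +
      (-(1 / 48 * g)) • (∑ ν, ∑ l, (cD g A ν (strength g A μ l) * strength g A l ν -
        strength g A l ν * cD g A ν (strength g A μ l))) := rfl
  rw [h]
  funext μ
  have h1 : ∑ ν, ∑ ρ, cD g A ν (cD g A ν (cD g A ρ (strength g A ρ μ))) =
      -(1 : ℝ) • ∑ ν, cD g A ν (cD g A ν (covCurl g A (dualF g A) μ)) := by
    simp only [← map_sum, sum_cD_strength, map_smul, Finset.smul_sum]
  have h2 : ∑ ν, ∑ ρ, cD g A ν (cD g A μ (cD g A ρ (strength g A ρ ν))) =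
      -(1 : ℝ) • ∑ ν, cD g A ν (cD g A μ (covCurl g A (dualF g A) ν)) := by
    simp only [← map_sum, sum_cD_strength, map_smul, Finset.smul_sum]
  rw [h1, h2, sum_commutator_divergence_strength, sum_commutator_cD_strength]
  simp only [Pi.add_apply, Pi.smul_apply, covCurl_covCurl g A (covCurl g A (dualF g A))]
  module

end

end ChernSimonsYM

end

noncomputable section

namespace ChernSimonsYM

variable {N : ℕ}

section conv

variable {U V W : Type*} [AddCommGroup U] [AddCommGroup V] [AddCommGroup W] [Module ℝ U]
    [Module ℝ V] [Module ℝ W] (f : U →ₗ[ℝ] V →ₗ[ℝ] W) {u : ℕ → U} {v : ℕ → V}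

theorem conv_zero (hu : u 0 = 0) : conv f u v 0 = 0 := by
  simp [conv, hu]

theorem conv_one (hu : u 0 = 0) (hv : v 0 = 0) : conv f u v 1 = 0 := by
  simp [conv, Finset.Nat.antidiagonal_succ, hu, hv]

theorem conv_two (hu : u 0 = 0) (hv : v 0 = 0) : conv f u v 2 = f (u 1) (v 1) := by
  simp [conv, Finset.Nat.antidiagonal_succ, hu, hv]

theorem conv_three (hu : u 0 = 0) (hv : v 0 = 0) : conv f u v 3 = f (u 1) (v 2) + f (u 2) (v 1) := by
  simp [conv, Finset.Nat.antidiagonal_succ, hu, hv]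

theorem conv_four (hu : u 0 = 0) (hv : v 0 = 0) : conv f u v 4 = f (u 1) (v 3) + f (u 2) (v 2) + f (u 3) (v 1) := by
  simp [conv, Finset.Nat.antidiagonal_succ, hu, hv, add_assoc]

end conv

section

variable (g : ℝ) (A : Fin 3 → schwartzFields N)

theorem dot_commutator_gradient (X : Fin 3 → schwartzFields N) :
    dot (fun μ => ∑ ν, (cD g A μ (X ν) * X ν - X ν * cD g A μ (X ν))) X =
      -dot (covCurl g A X) (cross X X) := by
  simp only [dot, covCurl, cross, Fin.sum_univ_three, epsDual_zero, epsDual_one, epsDual_two,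
    add_mul, sub_mul, mul_sub, map_add, map_sub, mul_assoc, intTr_mul_cycle (X _) (cD g A _ _)]
  ring

theorem dot_cross_anticomm (X Y : Fin 3 → schwartzFields N) :
    dot (cross X Y + cross Y X) Y = 2 * dot X (cross Y Y) := by
  rw [add_dot, dot_cross, dot_cross, dot_cross_cycle Y X Y, ← dot_cross, dot_cross, two_mul]

theorem remainder_two {a : ℕ → Fin 3 → schwartzFields N} (h0 : a 0 = 0)
    (h1 : a 1 = CovTensor.coeff₁.vecS g A) (h2 : a 2 = CovTensor.coeff₂.vecS g A) :
    (2 : ℝ) • dot (a 2) (dualF g A) + remainder g A a 2 = 0 := by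
  rw [vecS_coeff₁] at h1
  rw [vecS_coeff₂] at h2
  rw [remainder, conv_two _ h0 h0, conv_two _ (conv_zero _ h0) h0, conv_one _ h0 h0]
  simp only [h1, h2, LinearMap.compl₂_apply, dotL_apply, covCurlL_apply, map_zero,
    LinearMap.zero_apply, covCurl_smul, smul_dot, dot_smul, dot_covCurl, Complex.real_smul]
  push_cast
  ring

theorem remainder_three {a : ℕ → Fin 3 → schwartzFields N} (h0 : a 0 = 0)
    (h1 : a 1 = CovTensor.coeff₁.vecS g A) (h2 : a 2 = CovTensor.coeff₂.vecS g A)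
    (h3 : a 3 = (CovTensor.coeff₃ g).vecS g A) :
    (2 : ℝ) • dot (a 3) (dualF g A) + remainder g A a 3 = 0 := by
  rw [vecS_coeff₁] at h1
  rw [vecS_coeff₂] at h2
  rw [vecS_coeff₃] at h3
  rw [remainder, conv_three _ h0 h0, conv_three _ (conv_zero _ h0) h0, conv_one _ h0 h0,
    conv_two _ h0 h0]
  simp only [h1, h2, h3, LinearMap.compl₂_apply, dotL_apply, covCurlL_apply, crossL_apply, map_zero,
    LinearMap.zero_apply, covCurl_smul, smul_dot, dot_smul, dot_covCurl, cross_smul_left,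
    cross_smul_right, add_dot, Complex.real_smul]
  push_cast
  ring

theorem remainder_four {a : ℕ → Fin 3 → schwartzFields N} (h0 : a 0 = 0)
    (h1 : a 1 = CovTensor.coeff₁.vecS g A) (h2 : a 2 = CovTensor.coeff₂.vecS g A)
    (h3 : a 3 = (CovTensor.coeff₃ g).vecS g A) (h4 : a 4 = (CovTensor.coeff₄ g).vecS g A) :
    (2 : ℝ) • dot (a 4) (dualF g A) + remainder g A a 4 = 0 := by
  rw [vecS_coeff₁] at h1
  rw [vecS_coeff₂] at h2
  rw [vecS_coeff₃] at h3
  rw [vecS_coeff₄] at h4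
  rw [remainder, conv_four _ h0 h0, conv_four _ (conv_zero _ h0) h0, conv_one _ h0 h0,
    conv_two _ h0 h0, conv_three _ h0 h0]
  have hK : dot (covCurl g A (covCurl g A (dualF g A))) (covCurl g A (dualF g A)) =
      dot (covCurl g A (dualF g A)) (covCurl g A (covCurl g A (dualF g A))) := dot_comm _ _
  have hX (X Y : Fin 3 → schwartzFields N) : dot (cross X X) Y = dot Y (cross X X) := dot_comm _ _
  have hs := dot_cross_anticomm (covCurl g A (dualF g A)) (dualF g A)
  have hs' : dot (cross (dualF g A) (covCurl g A (dualF g A)) +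
      cross (covCurl g A (dualF g A)) (dualF g A)) (dualF g A) =
      2 * dot (covCurl g A (dualF g A)) (cross (dualF g A) (dualF g A)) := by
    rw [add_comm, hs]
  rw [add_dot, dot_covCurl] at hs'
  simp only [h1, h2, h3, h4, LinearMap.compl₂_apply, dotL_apply, covCurlL_apply, crossL_apply,
    map_zero, LinearMap.zero_apply, covCurl_smul, covCurl_add, dot_add, smul_dot, dot_smul,
    dot_covCurl, cross_smul_left, cross_smul_right, add_dot, dot_commutator_gradient, hs, hK, hX,
    Complex.real_smul]
  push_cast
  linear_combination (-(g : ℂ) / 48) * hs'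

end

end ChernSimonsYM

end

noncomputable section

namespace ChernSimonsYM

variable {N : ℕ}

/-- A functional of Schwartz gauge fields that is the pairing of a covariant vector with the dual
field strength. -/
def IsPairing (g : ℝ) (L : ∀ N, (Fin 3 → schwartzFields N) → ℂ) : Prop :=
  ∃ Z : CovTensor 1, ∀ N (A : Fin 3 → schwartzFields N), L N A = dot (Z.vecS g A) (dualF g A)

variable {g : ℝ} {L L' : ∀ N, (Fin 3 → schwartzFields N) → ℂ}

theorem IsPairing.add (h : IsPairing g L) (h' : IsPairing g L') :
    IsPairing g fun N A => L N A + L' N A := by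
  obtain ⟨Z, hZ⟩ := h
  obtain ⟨Z', hZ'⟩ := h'
  exact ⟨.add Z Z', fun N A => by beta_reduce; rw [hZ, hZ', ← add_dot]; rfl⟩

theorem IsPairing.smul (a : ℝ) (h : IsPairing g L) : IsPairing g fun N A => a • L N A := by
  obtain ⟨Z, hZ⟩ := h
  exact ⟨.smul a Z, fun N A => by beta_reduce; rw [hZ, ← smul_dot]; rfl⟩

theorem isPairing_zero : IsPairing g fun _ _ => 0 :=
  ⟨.smul 0 (.contract (.D .F)), fun N A => by
    have : (CovTensor.smul 0 (.contract (.D .F))).vecS g A =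
      (0 : ℝ) • (CovTensor.contract (.D .F)).vecS g A := rfl
    rw [this, smul_dot, zero_smul]⟩

theorem IsPairing.sum {ι : Type*} (s : Finset ι) {M : ι → ∀ N, (Fin 3 → schwartzFields N) → ℂ}
    (h : ∀ i ∈ s, IsPairing g (M i)) : IsPairing g fun N A => ∑ i ∈ s, M i N A := by
  classical
  induction s using Finset.induction_on with
  | empty => exact isPairing_zero
  | insert i s hi ih =>
    simp only [Finset.sum_insert hi]
    exact (h i (Finset.mem_insert_self i s)).add
      (ih fun j hj => h j (Finset.mem_insert_of_mem hj))

theorem isPairing_dot (X Y : CovTensor 1) :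
    IsPairing g fun _ A => dot (X.vecS g A) (Y.vecS g A) := by
  obtain ⟨Z, hZ⟩ := X.exists_pairing g Y
  refine ⟨Z, fun N A => ?_⟩
  rw [← hZ]
  exact Fintype.sum_equiv (Equiv.funUnique (Fin 1) (Fin 3)).symm _ _ fun μ => rfl

theorem isPairing_dot_covCurl (X Y : CovTensor 1) :
    IsPairing g fun _ A => dot (X.vecS g A) (covCurl g A (Y.vecS g A)) := by
  obtain ⟨Z, hZ⟩ := isPairing_dot (g := g) X (.epsDual (.D Y))
  refine ⟨Z, fun N A => ?_⟩
  rw [← hZ]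
  beta_reduce
  rw [CovTensor.vecS_epsDual]
  congr 1
  simp only [covCurl, CovTensor.evalS, CovTensor.vecS]
  congr 1
  funext ν ρ
  congr 2
  funext k
  rw [Subsingleton.elim k 0]
  rfl

theorem isPairing_dot_cross (X Y Z : CovTensor 1) :
    IsPairing g fun _ A => dot (cross (X.vecS g A) (Y.vecS g A) + cross (Y.vecS g A) (X.vecS g A))
      (Z.vecS g A) := by
  obtain ⟨W, hW⟩ := isPairing_dot (g := g) (.epsDual (.bracket X Y)) Z
  refine ⟨W, fun N A => ?_⟩
  rw [← hW]
  beta_reduce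
  rw [CovTensor.vecS_epsDual]
  congr 1
  have h : (fun ν ρ => (CovTensor.bracket X Y).evalS g A ![ν, ρ]) = fun ν ρ =>
      X.vecS g A ν * Y.vecS g A ρ - Y.vecS g A ρ * X.vecS g A ν := by
    funext ν ρ
    have h1 : (fun k : Fin 1 => (![ν, ρ] : Fin 2 → Fin 3) (Fin.castAdd 1 k)) = fun _ => ν := by
      funext k
      rw [Subsingleton.elim k 0]
      rfl
    have h2 : (fun k : Fin 1 => (![ν, ρ] : Fin 2 → Fin 3) (Fin.natAdd 1 k)) = fun _ => ρ := by
      funext k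
      rw [Subsingleton.elim k 0]
      rfl
    simp only [CovTensor.evalS, CovTensor.vecS]
    rw [h1, h2]
  rw [h]
  funext μ
  revert μ
  apply Fin.forall_three <;>
  simp only [cross, Pi.add_apply, epsDual_zero, epsDual_one, epsDual_two] <;> module

theorem conv_crossL_symm (a : ℕ → Fin 3 → schwartzFields N) (n : ℕ) :
    conv crossL a a n = (1 / 2 : ℝ) • ∑ p ∈ Finset.HasAntidiagonal.antidiagonal n,
      (cross (a p.1) (a p.2) + cross (a p.2) (a p.1)) := by
  have h : conv crossL a a n = ∑ p ∈ Finset.HasAntidiagonal.antidiagonal n,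
      cross (a p.2) (a p.1) := by
    rw [conv, ← Finset.Nat.sum_antidiagonal_swap]
    rfl
  rw [Finset.sum_add_distrib, ← h]
  change _ = (1 / 2 : ℝ) • (conv crossL a a n + conv crossL a a n)
  module

theorem isPairing_remainder (ϑ : ℕ → CovTensor 1) (n : ℕ) :
    IsPairing g fun _ A => remainder g A (fun i => (ϑ i).vecS g A) n := by
  refine IsPairing.add (IsPairing.sum _ fun p _ => isPairing_dot_covCurl _ _) (.smul _ ?_)
  refine IsPairing.sum _ fun p _ => ?_
  simp only [conv_crossL_symm, map_smul, map_sum, LinearMap.smul_apply, LinearMap.sum_apply]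
  exact .smul _ (.sum _ fun q _ => isPairing_dot_cross _ _ _)

theorem remainder_congr (A : Fin 3 → schwartzFields N) {a b : ℕ → Fin 3 → schwartzFields N}
    {n : ℕ} (ha : a 0 = 0) (hb : b 0 = 0) (h : ∀ i < n, a i = b i) :
    remainder g A a n = remainder g A b n := by
  have key {V W : Type} [AddCommGroup V] [AddCommGroup W] [Module ℝ V] [Module ℝ W]
      (f : V →ₗ[ℝ] (Fin 3 → schwartzFields N) →ₗ[ℝ] W) {u v : ℕ → V} (hu : u 0 = 0) (hv : v 0 = 0)
      (huv : ∀ i < n, u i = v i) : conv f u a n = conv f v b n := by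
    refine Finset.sum_congr rfl fun p hp => ?_
    have hp' := Finset.HasAntidiagonal.mem_antidiagonal.1 hp
    rcases Nat.eq_zero_or_pos p.1 with h1 | h1
    · rw [h1, hu, hv, map_zero, LinearMap.zero_apply, LinearMap.zero_apply]
    · rcases Nat.eq_zero_or_pos p.2 with h2 | h2
      · rw [h2, ha, hb, map_zero, map_zero]
      · rw [huv _ (by omega), h _ (by omega)]
  rw [remainder, remainder, key _ ha hb h, key _ (conv_zero crossL ha) (conv_zero crossL hb)]
  intro i hi
  refine Finset.sum_congr rfl fun p hp => ?_
  have hp' := Finset.HasAntidiagonal.mem_antidiagonal.1 hp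
  rw [h _ (by omega), h _ (by omega)]

/-- A sequence defined by recursion on all previous members. -/
def recSeq {α : Type} (z : α) (pick : ℕ → (ℕ → α) → α) (n : ℕ) : α :=
  pick n fun i => if _ : i < n then recSeq z pick i else z
termination_by n

theorem exists_recSeq {α : Type} (z : α) (pick : ℕ → (ℕ → α) → α) :
    ∃ u : ℕ → α, ∀ n, u n = pick n fun i => if i < n then u i else z :=
  ⟨recSeq z pick, fun n => by rw [recSeq]; rfl⟩

theorem exists_coefficients (g : ℝ) : ∃ ϑ : ℕ → CovTensor 1,
    ϑ 1 = .coeff₁ ∧ ϑ 2 = .coeff₂ ∧ ϑ 3 = .coeff₃ g ∧ ϑ 4 = .coeff₄ g ∧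
    ∀ (N : ℕ) (A : Fin 3 → schwartzFields N), (ϑ 0).vecS g A = 0 ∧ ∀ n, 2 ≤ n →
      (2 : ℝ) • dot ((ϑ n).vecS g A) (dualF g A) +
        remainder g A (fun i => (ϑ i).vecS g A) n = 0 := by
  choose next hnext using fun (n : ℕ) (ϑ : ℕ → CovTensor 1) => isPairing_remainder (g := g) ϑ n
  let z : CovTensor 1 := .smul 0 (.contract (.D .F))
  have hz : ∀ N (A : Fin 3 → schwartzFields N), z.vecS g A = 0 := fun N A => by
    have : z.vecS g A = (0 : ℝ) • (CovTensor.contract (.D .F)).vecS g A := rfl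
    rw [this, zero_smul]
  obtain ⟨ϑ, hϑ⟩ := exists_recSeq z fun n ϑ => match n with
    | 0 => z
    | 1 => .coeff₁
    | 2 => .coeff₂
    | 3 => .coeff₃ g
    | 4 => .coeff₄ g
    | n + 5 => .smul (-(1 / 2)) (next (n + 5) ϑ)
  have h0 : ϑ 0 = z := hϑ 0
  have h1 : ϑ 1 = .coeff₁ := hϑ 1
  have h2 : ϑ 2 = .coeff₂ := hϑ 2
  have h3 : ϑ 3 = .coeff₃ g := hϑ 3
  have h4 : ϑ 4 = .coeff₄ g := hϑ 4
  have h5 (n : ℕ) : ϑ (n + 5) = .smul (-(1 / 2)) (next (n + 5)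
    fun i => if i < n + 5 then ϑ i else z) := hϑ (n + 5)
  refine ⟨ϑ, h1, h2, h3, h4, fun N A => ⟨by rw [h0, hz], fun n hn => ?_⟩⟩
  have hA : (fun i => (ϑ i).vecS g A) 0 = 0 := by
    simp only [h0, hz]
  have e1 : (ϑ 1).vecS g A = CovTensor.coeff₁.vecS g A := by rw [h1]
  have e2 : (ϑ 2).vecS g A = CovTensor.coeff₂.vecS g A := by rw [h2]
  have e3 : (ϑ 3).vecS g A = (CovTensor.coeff₃ g).vecS g A := by rw [h3]
  have e4 : (ϑ 4).vecS g A = (CovTensor.coeff₄ g).vecS g A := by rw [h4]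
  match n, hn with
  | 2, _ => exact remainder_two g A (a := fun i => (ϑ i).vecS g A) hA e1 e2
  | 3, _ => exact remainder_three g A (a := fun i => (ϑ i).vecS g A) hA e1 e2 e3
  | 4, _ => exact remainder_four g A (a := fun i => (ϑ i).vecS g A) hA e1 e2 e3 e4
  | n + 5, _ =>
    have h5' : (ϑ (n + 5)).vecS g A = (-(1 / 2) : ℝ) • (next (n + 5)
        fun i => if i < n + 5 then ϑ i else z).vecS g A := by rw [h5]; rfl
    have hr : remainder g A (fun i => (ϑ i).vecS g A) (n + 5) = remainder g A
        (fun i => (if i < n + 5 then ϑ i else z).vecS g A) (n + 5) := by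
      refine remainder_congr A hA ?_ fun i hi => ?_
      · simp only [Nat.zero_lt_succ, if_true, h0, hz]
      · simp only [hi, if_true]
    rw [h5', smul_dot, ← hnext, hr]
    module

end ChernSimonsYM

end

noncomputable section

namespace ChernSimonsYM

open MeasureTheory

variable {N : ℕ} (g : ℝ) (A : Fin 3 → schwartzFields N)

theorem coeff_real_smul (n : ℕ) (r : ℝ) (φ : PowerSeries (Space → Mat N)) :
    PowerSeries.coeff n (r • φ) = r • PowerSeries.coeff n φ := rfl

theorem coeff_chernSimonsDensitySeries {φ : Fin 3 → PowerSeries (Space → Mat N)}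
    {a : ℕ → Fin 3 → schwartzFields N}
    (h : ∀ n μ, PowerSeries.coeff n (φ μ) = (a n μ : Space → Mat N)) (n : ℕ) :
    PowerSeries.coeff n (chernSimonsDensitySeries g φ) =
      (densityCoeff g a n : Space → Mat N) := by
  simp only [chernSimonsDensitySeries, densityCoeff, epsDual, map_sum, coeff_real_smul, map_add,
    PowerSeries.coeff_mul, partialDSeries, PowerSeries.coeff_mk, h]
  push_cast
  rfl

theorem coeff_redefined {ϑ : ℕ → CovTensor 1} (h0 : (ϑ 0).vecS g A = 0) (n : ℕ) (μ : Fin 3) :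
    PowerSeries.coeff n (redefined g ϑ (fun ν => (A ν : Space → Mat N)) μ) =
      ((Pi.single 0 A + fun i => (ϑ i).vecS g A : ℕ → Fin 3 → schwartzFields N) n μ :
        schwartzFields N) := by
  rw [redefined, PowerSeries.coeff_mk]
  split_ifs with hn
  · subst hn
    simp [h0]
  · rw [Pi.add_apply, Pi.single_eq_of_ne hn, zero_add, CovTensor.coe_vecS]

theorem intTr_sum_strength_mul_strength :
    intTr (∑ μ, ∑ ν, strength g A μ ν * strength g A μ ν) =
      2 * dot (dualF g A) (dualF g A) := by
  simp only [dot, Fin.sum_univ_three, strength_self, strength_zero_one, strength_one_two,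
    strength_two_zero, strength_one_zero, strength_two_one, strength_zero_two, smul_mul_assoc,
    mul_smul_comm, zero_mul, map_add, map_smul, map_zero, Complex.real_smul]
  push_cast
  ring

theorem traceFF_eq (x : Space) : traceFF g (fun ν => (A ν : Space → Mat N)) x =
    Matrix.trace (((∑ μ, ∑ ν, strength g A μ ν * strength g A μ ν : schwartzFields N) :
      Space → Mat N) x) := by
  rw [traceFF]
  congr 1

theorem chernSimons_eq (a : ℕ → Fin 3 → schwartzFields N) (ha : a 0 = A) :
    chernSimons g (fun ν => (A ν : Space → Mat N)) = (1 / 2 : ℂ) * intTr (densityCoeff g a 0) := by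
  rw [chernSimons, intTr_apply]
  congr 3
  ext x
  congr 1
  simp only [densityCoeff, Finset.Nat.antidiagonal_zero, Finset.sum_singleton, epsDual, ha]
  push_cast
  simp only [Finset.sum_apply]
  rfl

theorem chernSimonsSeries_redefined {ϑ : ℕ → CovTensor 1} (h0 : (ϑ 0).vecS g A = 0)
    (h1 : ϑ 1 = .coeff₁)
    (h : ∀ n, 2 ≤ n → (2 : ℝ) • dot ((ϑ n).vecS g A) (dualF g A) +
        remainder g A (fun i => (ϑ i).vecS g A) n = 0) :
    chernSimonsSeries g (redefined g ϑ (fun ν => (A ν : Space → Mat N))) =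
      PowerSeries.C (chernSimons g (fun ν => (A ν : Space → Mat N))) +
        PowerSeries.X * PowerSeries.C
          ((1 / 4 : ℂ) * ∫ x, traceFF g (fun ν => (A ν : Space → Mat N)) x) := by
  have hF : ∫ x, traceFF g (fun ν => (A ν : Space → Mat N)) x =
      2 * dot (dualF g A) (dualF g A) := by
    rw [← intTr_sum_strength_mul_strength, intTr_apply]
    simp only [traceFF_eq]
  ext n
  rw [chernSimonsSeries, PowerSeries.coeff_mk, coeff_chernSimonsDensitySeries g
    (coeff_redefined g A h0), ← intTr_apply, hF]
  match n with
  | 0 =>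
    rw [← chernSimons_eq g A _ (by simp [h0])]
    simp
  | 1 =>
    have hr : remainder g A (fun i => (ϑ i).vecS g A) 1 = 0 := by
      rw [remainder, conv_one _ h0 h0, conv_one _ (conv_zero _ h0) h0]
      simp
    rw [intTr_densityCoeff_of_pos g A _ one_ne_zero, hr, h1, vecS_coeff₁, smul_dot, map_add,
      PowerSeries.coeff_C, if_neg one_ne_zero, ← zero_add 1, PowerSeries.coeff_succ_X_mul,
      PowerSeries.coeff_C, if_pos rfl]
    simp only [Complex.real_smul]
    push_cast
    ring
  | n + 2 =>
    rw [intTr_densityCoeff_of_pos g A _ (by omega), h _ (by omega), map_add,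
      PowerSeries.coeff_C, if_neg (by omega), PowerSeries.coeff_succ_X_mul,
      PowerSeries.coeff_C, if_neg (by omega)]
    simp

theorem integrable_density {ϑ : ℕ → CovTensor 1} (h0 : (ϑ 0).vecS g A = 0) (n : ℕ) :
    Integrable fun x => Matrix.trace (PowerSeries.coeff n (chernSimonsDensitySeries g
      (redefined g ϑ (fun ν => (A ν : Space → Mat N)))) x) := by
  rw [coeff_chernSimonsDensitySeries g (coeff_redefined g A h0)]
  exact IsSchwartz.integrable_trace (Subtype.property _)

theorem integrable_traceFF : Integrable (traceFF g (fun ν => (A ν : Space → Mat N))) := by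
  rw [funext (traceFF_eq g A)]
  exact IsSchwartz.integrable_trace (Subtype.property _)

end ChernSimonsYM

end

noncomputable section

namespace ChernSimonsYM

variable {N : ℕ}

/-- One-parameter families of matrix valued functions that are jointly smooth. -/
def IsSmoothFamily (φ : ℝ → Space → Mat N) : Prop :=
  ∀ i j, ContDiff ℝ ∞ fun p : ℝ × Space => φ p.1 p.2 i j

namespace IsSmoothFamily

variable {φ ψ : ℝ → Space → Mat N}

theorem isSmooth (h : IsSmoothFamily φ) (t : ℝ) : IsSmooth (φ t) := fun i j =>
  (h i j).comp (contDiff_const.prodMk contDiff_id)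

theorem of_isSmooth {φ : Space → Mat N} (h : IsSmooth φ) : IsSmoothFamily fun _ => φ :=
  fun i j => (h i j).comp contDiff_snd

theorem zero : IsSmoothFamily fun _ => (0 : Space → Mat N) := fun _ _ => contDiff_const

theorem add (hφ : IsSmoothFamily φ) (hψ : IsSmoothFamily ψ) :
    IsSmoothFamily fun t => φ t + ψ t :=
  fun i j => (hφ i j).add (hψ i j)

theorem sub (hφ : IsSmoothFamily φ) (hψ : IsSmoothFamily ψ) :
    IsSmoothFamily fun t => φ t - ψ t :=
  fun i j => (hφ i j).sub (hψ i j)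

theorem smul (a : ℝ) (hφ : IsSmoothFamily φ) : IsSmoothFamily fun t => a • φ t :=
  fun i j => (hφ i j).const_smul a

theorem id_smul (hφ : IsSmoothFamily φ) : IsSmoothFamily fun t => t • φ t :=
  fun i j => contDiff_fst.smul (hφ i j)

theorem mul (hφ : IsSmoothFamily φ) (hψ : IsSmoothFamily ψ) :
    IsSmoothFamily fun t => φ t * ψ t := fun i j => by
  simp only [Pi.mul_apply, Matrix.mul_apply]
  exact ContDiff.sum fun k _ => (hφ i k).mul (hψ k j)

theorem sum {ι : Type*} (s : Finset ι) {φ : ι → ℝ → Space → Mat N}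
    (h : ∀ i ∈ s, IsSmoothFamily (φ i)) : IsSmoothFamily fun t => ∑ i ∈ s, φ i t := fun i j => by
  simp only [Finset.sum_apply, Matrix.sum_apply]
  exact ContDiff.sum fun k hk => h k hk i j

theorem partialD (μ : Fin 3) (hφ : IsSmoothFamily φ) :
    IsSmoothFamily fun t => partialD μ (φ t) := fun i j => by
  have h : ContDiff ℝ ∞ (Function.uncurry fun (p : ℝ × Space) (y : Space) => φ p.1 y i j) :=
    (hφ i j).comp ((contDiff_fst.comp contDiff_fst).prodMk contDiff_snd)
  exact (h.fderiv (n := ∞) contDiff_snd le_rfl).clm_apply contDiff_const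

end IsSmoothFamily

theorem covD_eq (g : ℝ) (A : Fin 3 → Space → Mat N) (μ : Fin 3) (φ : Space → Mat N) :
    covD g A μ φ = partialD μ φ + g • (A μ * φ - φ * A μ) := rfl

theorem fieldStrength_eq (g : ℝ) (A : Fin 3 → Space → Mat N) (μ ν : Fin 3) :
    fieldStrength g A μ ν =
      partialD μ (A ν) - partialD ν (A μ) + g • (A μ * A ν - A ν * A μ) := rfl

theorem CovTensor.eval_contract (g : ℝ) (A : Fin 3 → Space → Mat N) {r : ℕ}
    (X : CovTensor (r + 2)) (I : Fin r → Fin 3) : X.contract.eval g A I =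
      ∑ a : Fin 3, X.eval g A (Fin.cons a (Fin.cons a I)) := by
  funext x
  simp [eval]

theorem CovTensor.isSmoothFamily_eval (g : ℝ) {A : ℝ → Fin 3 → Space → Mat N}
    (hA : ∀ μ, IsSmoothFamily fun t => A t μ) {r : ℕ} (X : CovTensor r) (I : Fin r → Fin 3) :
    IsSmoothFamily fun t => X.eval g (A t) I := by
  induction X with
  | F =>
    exact (((hA _).partialD _).sub ((hA _).partialD _)).add
      ((((hA _).mul (hA _)).sub ((hA _).mul (hA _))).smul g)
  | D X ih =>
    exact ((ih _).partialD _).add ((((hA _).mul (ih _)).sub ((ih _).mul (hA _))).smul g)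
  | bracket X Y ihX ihY => exact ((ihX _).mul (ihY _)).sub ((ihY _).mul (ihX _))
  | add X Y ihX ihY => exact (ihX _).add (ihY _)
  | smul a X ih => exact (ih _).smul a
  | eps X ih => exact (ih _).smul _
  | delta X ih =>
    by_cases h : I 0 = I 1
    · simpa only [eval, h, if_true] using ih _
    · simp only [eval, h, if_false]
      exact IsSmoothFamily.zero
  | contract X ih =>
    simp only [eval_contract]
    exact .sum _ fun a _ => ih _
  | reindex e X ih => exact ih _

theorem CovTensor.isSmooth_eval (g : ℝ) {A : Fin 3 → Space → Mat N} (hA : ∀ μ, IsSmooth (A μ))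
    {r : ℕ} (X : CovTensor r) (I : Fin r → Fin 3) : IsSmooth (X.eval g A I) :=
  (X.isSmoothFamily_eval g (A := fun _ => A) (fun μ => .of_isSmooth (hA μ)) I).isSmooth 0

theorem partialD_mem (μ : Fin 3) (S : Submodule ℝ (Mat N)) {φ : Space → Mat N} (hφ : IsSmooth φ)
    (h : ∀ x, φ x ∈ S) (x : Space) : partialD μ φ x ∈ S := by
  have hc : IsClosed (S : Set (Mat N)) := S.closed_of_finiteDimensional
  have ht : Filter.Tendsto
      (fun t : ℝ => t⁻¹ • (φ (x + t • EuclideanSpace.single μ (1 : ℝ)) - φ x))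
      (nhdsWithin 0 {0}ᶜ) (nhds (partialD μ φ x)) := by
    refine tendsto_pi_nhds.2 fun i => tendsto_pi_nhds.2 fun j => ?_
    exact ((hφ.differentiable i j x).hasFDerivAt.hasLineDerivAt _).tendsto_slope_zero
  exact hc.mem_of_tendsto ht
    (.of_forall fun t => S.smul_mem _ (S.sub_mem (h _) (h _)))

theorem CovTensor.eval_mem (g : ℝ) (𝔤 : LieSubalgebra ℝ (Mat N)) {A : Fin 3 → Space → Mat N}
    (hA : ∀ μ, IsSmooth (A μ)) (hA' : ∀ μ x, A μ x ∈ 𝔤) {r : ℕ} (X : CovTensor r)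
    (I : Fin r → Fin 3) (x : Space) : X.eval g A I x ∈ 𝔤 := by
  have hp (μ : Fin 3) {φ : Space → Mat N} (hφ : IsSmooth φ) (h : ∀ x, φ x ∈ 𝔤) (x : Space) :
      partialD μ φ x ∈ 𝔤 := partialD_mem μ 𝔤.toSubmodule hφ h x
  induction X generalizing x with
  | F =>
    exact 𝔤.add_mem (𝔤.sub_mem (hp _ (hA _) (hA' _) _) (hp _ (hA _) (hA' _) _))
      (𝔤.smul_mem _ (𝔤.lie_mem (hA' _ _) (hA' _ _)))
  | D X ih =>
    exact 𝔤.add_mem (hp _ (X.isSmooth_eval g hA _) (fun y => ih _ y) _)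
      (𝔤.smul_mem _ (𝔤.lie_mem (hA' _ _) (ih _ _)))
  | bracket X Y ihX ihY => exact 𝔤.lie_mem (ihX _ _) (ihY _ _)
  | add X Y ihX ihY => exact 𝔤.add_mem (ihX _ _) (ihY _ _)
  | smul a X ih => exact 𝔤.smul_mem _ (ih _ _)
  | eps X ih => exact 𝔤.smul_mem _ (ih _ _)
  | delta X ih =>
    simp only [eval]
    split_ifs
    · exact ih _ _
    · exact 𝔤.zero_mem
  | contract X ih => exact sum_mem fun a _ => ih _ _
  | reindex e X ih => exact ih _ _

/-- `ψ` is the derivative at zero of the one-parameter family `φ`. -/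
def HasVariation (φ : ℝ → Space → Mat N) (ψ : Space → Mat N) : Prop :=
  ∀ x i j, HasDerivAt (fun t => φ t x i j) (ψ x i j) 0

namespace HasVariation

variable {φ χ : ℝ → Space → Mat N} {ψ ξ : Space → Mat N}

theorem congr {ψ' : Space → Mat N} (h : HasVariation φ ψ) (e : ψ' = ψ) : HasVariation φ ψ' :=
  e ▸ h

theorem zero : HasVariation (fun _ => 0) (0 : Space → Mat N) :=
  fun _ _ _ => hasDerivAt_const _ _

theorem add (h : HasVariation φ ψ) (h' : HasVariation χ ξ) :
    HasVariation (fun t => φ t + χ t) (ψ + ξ) :=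
  fun x i j => (h x i j).add (h' x i j)

theorem sub (h : HasVariation φ ψ) (h' : HasVariation χ ξ) :
    HasVariation (fun t => φ t - χ t) (ψ - ξ) :=
  fun x i j => (h x i j).sub (h' x i j)

theorem smul (a : ℝ) (h : HasVariation φ ψ) : HasVariation (fun t => a • φ t) (a • ψ) :=
  fun x i j => (h x i j).const_smul a

theorem mul (h : HasVariation φ ψ) (h' : HasVariation χ ξ) :
    HasVariation (fun t => φ t * χ t) (ψ * χ 0 + φ 0 * ξ) := fun x i j => by
  simp only [Pi.mul_apply, Pi.add_apply, Matrix.mul_apply, Matrix.add_apply,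
    ← Finset.sum_add_distrib]
  exact HasDerivAt.fun_sum fun k _ => (h x i k).mul (h' x k j)

theorem sum {ι : Type*} (s : Finset ι) {φ : ι → ℝ → Space → Mat N} {ψ : ι → Space → Mat N}
    (h : ∀ i ∈ s, HasVariation (φ i) (ψ i)) :
    HasVariation (fun t => ∑ i ∈ s, φ i t) (∑ i ∈ s, ψ i) := fun x i j => by
  simp only [Finset.sum_apply, Matrix.sum_apply]
  exact HasDerivAt.fun_sum fun k hk => h k hk x i j

theorem partialD (μ : Fin 3) (h : HasVariation φ ψ) (hs : IsSmoothFamily φ) :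
    HasVariation (fun t => partialD μ (φ t)) (partialD μ ψ) := fun x i j => by
  set Φ : ℝ × Space → ℂ := fun p => φ p.1 p.2 i j
  set e : Space := EuclideanSpace.single μ (1 : ℝ)
  have hΦ : ContDiff ℝ ∞ Φ := hs i j
  have hd : Differentiable ℝ Φ := hΦ.differentiable (by simp)
  have hd2 : Differentiable ℝ (fderiv ℝ Φ) :=
    (contDiff_infty_iff_fderiv.1 hΦ).2.differentiable (by simp)
  have hx (t : ℝ) (y : Space) : HasFDerivAt (fun y => ((t, y) : ℝ × Space))
      (ContinuousLinearMap.inr ℝ ℝ Space) y := hasFDerivAt_prodMk_right t y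
  have ht (t : ℝ) (y : Space) : HasDerivAt (fun t => ((t, y) : ℝ × Space)) (1, 0) t :=
    (hasDerivAt_id t).prodMk (hasDerivAt_const t y)
  have h1 : (fun t => ChernSimonsYM.partialD μ (φ t) x i j) =
      fun t => fderiv ℝ Φ (t, x) (0, e) := by
    funext t
    have := HasFDerivAt.comp (g := Φ) x (hd (t, x)).hasFDerivAt (hx t x)
    exact congrArg (fun L : Space →L[ℝ] ℂ => L e) this.fderiv
  have h2 : (fun y => ψ y i j) = fun y => fderiv ℝ Φ (0, y) (1, 0) := by
    funext y
    exact (h y i j).unique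
      (HasFDerivAt.comp_hasDerivAt (l := Φ) 0 (hd (0, y)).hasFDerivAt (ht 0 y))
  have h3 : ChernSimonsYM.partialD μ ψ x i j = fderiv ℝ (fderiv ℝ Φ) (0, x) (0, e) (1, 0) := by
    rw [partialD_apply, h2]
    have h4 := (HasFDerivAt.comp (g := fderiv ℝ Φ) x (hd2 (0, x)).hasFDerivAt (hx 0 x)).clm_apply
      (hasFDerivAt_const ((1, 0) : ℝ × Space) x)
    refine (congrArg (fun L : Space →L[ℝ] ℂ => L e) h4.fderiv).trans ?_
    simp
  have hsymm : IsSymmSndFDerivAt ℝ Φ (0, x) :=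
    hΦ.contDiffAt.isSymmSndFDerivAt (by simpa using ENat.LEInfty.out)
  rw [h1, h3, hsymm]
  have h5 := (HasFDerivAt.comp_hasDerivAt (l := fderiv ℝ Φ) 0 (hd2 (0, x)).hasFDerivAt
    (ht 0 x)).clm_apply (hasDerivAt_const 0 ((0, e) : ℝ × Space))
  refine h5.congr_deriv ?_
  simp

end HasVariation

theorem IsSmooth.partialD (μ : Fin 3) {φ : Space → Mat N} (h : IsSmooth φ) :
    IsSmooth (partialD μ φ) :=
  ((IsSmoothFamily.of_isSmooth h).partialD μ).isSmooth 0

theorem IsSmooth.mul {φ ψ : Space → Mat N} (h : IsSmooth φ) (h' : IsSmooth ψ) :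
    IsSmooth (φ * ψ) :=
  ((IsSmoothFamily.of_isSmooth h).mul (.of_isSmooth h')).isSmooth 0

theorem IsSmooth.sub {φ ψ : Space → Mat N} (h : IsSmooth φ) (h' : IsSmooth ψ) :
    IsSmooth (φ - ψ) :=
  ((IsSmoothFamily.of_isSmooth h).sub (.of_isSmooth h')).isSmooth 0

theorem IsSmooth.smul (a : ℝ) {φ : Space → Mat N} (h : IsSmooth φ) : IsSmooth (a • φ) :=
  ((IsSmoothFamily.of_isSmooth h).smul a).isSmooth 0

theorem IsSmooth.covD (g : ℝ) {A : Fin 3 → Space → Mat N} (hA : ∀ μ, IsSmooth (A μ)) (μ : Fin 3)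
    {φ : Space → Mat N} (h : IsSmooth φ) : IsSmooth (covD g A μ φ) :=
  ((IsSmoothFamily.of_isSmooth (h.partialD μ)).add (.of_isSmooth
    ((((hA μ).mul h).sub (h.mul (hA μ))).smul g))).isSmooth 0

theorem partialD_sub (μ : Fin 3) {φ ψ : Space → Mat N} (hφ : IsSmooth φ) (hψ : IsSmooth ψ) :
    partialD μ (φ - ψ) = partialD μ φ - partialD μ ψ := by
  have h := partialD_add μ (hφ.sub hψ) hψ
  rw [sub_add_cancel] at h
  rw [h, add_sub_cancel_right]

theorem partialD_commutator (g : ℝ) (μ : Fin 3) {φ ψ : Space → Mat N} (hφ : IsSmooth φ)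
    (hψ : IsSmooth ψ) : partialD μ (g • (φ * ψ - ψ * φ)) =
      g • (partialD μ φ * ψ + φ * partialD μ ψ - (partialD μ ψ * φ + ψ * partialD μ φ)) := by
  rw [partialD_smul _ _ ((hφ.mul hψ).sub (hψ.mul hφ)), partialD_sub _ (hφ.mul hψ) (hψ.mul hφ),
    partialD_mul _ hφ hψ, partialD_mul _ hψ hφ]

section variation

variable (g : ℝ) {A : Fin 3 → Space → Mat N} {c : Space → Mat N}

theorem CovTensor.hasVariation_eval (hA : ∀ μ, IsSmooth (A μ)) (hc : IsSmooth c) {r : ℕ}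
    (X : CovTensor r) (I : Fin r → Fin 3) :
    HasVariation (fun t => X.eval g (fun ν => A ν + t • covD g A ν c) I)
      (g • (X.eval g A I * c - c * X.eval g A I)) := by
  have h0 : (fun ν => A ν + (0 : ℝ) • covD g A ν c) = A := by
    funext ν
    rw [zero_smul, add_zero]
  have hs (ν : Fin 3) : IsSmoothFamily fun t : ℝ => A ν + t • covD g A ν c :=
    (IsSmoothFamily.of_isSmooth (hA ν)).add (.id_smul (.of_isSmooth (hc.covD g hA ν)))
  have hv (ν : Fin 3) : HasVariation (fun t : ℝ => A ν + t • covD g A ν c) (covD g A ν c) := by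
    intro x i j
    have := ((hasDerivAt_id (0 : ℝ)).smul_const (covD g A ν c x i j)).const_add (A ν x i j)
    simpa using this
  induction X with
  | F =>
    have h := (((hv (I 1)).partialD (I 0) (hs (I 1))).sub ((hv (I 0)).partialD (I 1) (hs (I 0)))).add
      ((((hv (I 0)).mul (hv (I 1))).sub ((hv (I 1)).mul (hv (I 0)))).smul g)
    refine h.congr ?_
    simp only [eval, fieldStrength_eq, zero_smul, add_zero]
    simp only [covD_eq]
    rw [partialD_add _ (hc.partialD _) (((hA _).mul hc).sub (hc.mul (hA _)) |>.smul g),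
      partialD_add _ (hc.partialD _) (((hA _).mul hc).sub (hc.mul (hA _)) |>.smul g),
      partialD_commutator g _ (hA _) hc, partialD_commutator g _ (hA _) hc,
      partialD_comm (I 0) (I 1) hc]
    simp only [mul_add, mul_sub, add_mul, sub_mul, mul_smul_comm, smul_mul_assoc, mul_assoc]
    module
  | D X ih =>
    have hX := ih fun k => I k.succ
    have h := (hX.partialD (I 0) (X.isSmoothFamily_eval g hs _)).add
      ((((hv (I 0)).mul hX).sub (hX.mul (hv (I 0)))).smul g)
    refine h.congr ?_
    simp only [eval, zero_smul, add_zero]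
    set Y := X.eval g A fun k => I k.succ
    have hY : IsSmooth Y := X.isSmooth_eval g hA _
    rw [partialD_commutator g _ hY hc]
    simp only [covD_eq]
    simp only [mul_add, mul_sub, add_mul, sub_mul, mul_smul_comm, smul_mul_assoc, mul_assoc]
    module
  | @bracket r s X Y ihX ihY =>
    have h := ((ihX fun k => I (Fin.castAdd s k)).mul (ihY fun k => I (Fin.natAdd r k))).sub
      ((ihY fun k => I (Fin.natAdd r k)).mul (ihX fun k => I (Fin.castAdd s k)))
    refine h.congr ?_
    have e : (bracket X Y).eval g A I =
      X.eval g A (fun k => I (Fin.castAdd s k)) * Y.eval g A (fun k => I (Fin.natAdd r k)) -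
      Y.eval g A (fun k => I (Fin.natAdd r k)) * X.eval g A (fun k => I (Fin.castAdd s k)) := rfl
    rw [e, h0]
    simp only [mul_sub, sub_mul, mul_smul_comm, smul_mul_assoc, mul_assoc]
    module
  | add X Y ihX ihY =>
    refine ((ihX I).add (ihY I)).congr ?_
    have e : (add X Y).eval g A I = X.eval g A I + Y.eval g A I := rfl
    rw [e, mul_add, add_mul]
    module
  | smul a X ih =>
    refine ((ih I).smul a).congr ?_
    have e : (smul a X).eval g A I = a • X.eval g A I := rfl
    rw [e, mul_smul_comm, smul_mul_assoc, ← smul_sub, smul_comm g]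
  | eps X ih =>
    refine ((ih fun k => I k.succ.succ.succ).smul (leviCivita (I 0) (I 1) (I 2))).congr ?_
    have e : X.eps.eval g A I = leviCivita (I 0) (I 1) (I 2) •
      X.eval g A fun k => I k.succ.succ.succ := rfl
    rw [e, mul_smul_comm, smul_mul_assoc, ← smul_sub, smul_comm g]
  | delta X ih =>
    by_cases h : I 0 = I 1
    · simpa only [eval, h, if_true] using ih _
    · have e (B : Fin 3 → Space → Mat N) : X.delta.eval g B I = 0 := by
        funext x
        simp only [eval, h, if_false]
        rfl
      simp only [e, zero_mul, mul_zero, sub_zero, smul_zero]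
      exact HasVariation.zero
  | contract X ih =>
    simp only [eval_contract]
    refine (HasVariation.sum Finset.univ fun a _ => ih (Fin.cons a (Fin.cons a I))).congr ?_
    rw [← Finset.smul_sum, Finset.sum_sub_distrib, Finset.sum_mul, Finset.mul_sum]
  | reindex e X ih => exact ih _

end variation

end ChernSimonsYM

end

open ChernSimonsYM
theorem mainTheorem1 (g : ℝ) :
    ∃ ϑ : ℕ → CovTensor 1,
      ∀ (N : ℕ) (𝔤 : LieSubalgebra ℝ (Mat N)),
        (∀ T ∈ 𝔤, T.conjTranspose = -T) → LieAlgebra.IsSemisimple ℝ 𝔤 →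
        -- local properties, for every smooth gauge field
        (∀ A : Fin 3 → Space → Mat N,
          (∀ μ, IsSmooth (A μ)) → (∀ μ x, A μ x ∈ 𝔤) →
          -- the first four coefficients
          (∀ μ, (ϑ 1).vec g A μ = theta1 g A μ ∧ (ϑ 2).vec g A μ = theta2 g A μ ∧
            (ϑ 3).vec g A μ = theta3 g A μ ∧ (ϑ 4).vec g A μ = theta4 g A μ) ∧
          -- the coefficients take values in the Lie algebra
          (∀ n, 1 ≤ n → ∀ μ x, (ϑ n).vec g A μ x ∈ 𝔤) ∧
          -- under `δA_μ = D_μ c` they transform as `δϑⁿ_μ = g [ϑⁿ_μ, c]`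
          (∀ c : Space → Mat N, IsSmooth c → (∀ x, c x ∈ 𝔤) →
            ∀ n, 1 ≤ n → ∀ μ x i j,
              HasDerivAt
                (fun t : ℝ => (ϑ n).vec g (fun ν y => A ν y + t • covD g A ν c y) μ x i j)
                ((g • ⁅(ϑ n).vec g A μ x, c x⁆) i j) 0)) ∧
        -- equality of the actions, as formal power series in `1/m`
        (∀ A : Fin 3 → Space → Mat N,
          (∀ μ, IsSchwartz (A μ)) → (∀ μ x, A μ x ∈ 𝔤) →
          (∀ n, MeasureTheory.Integrable (fun x => Matrix.trace
            (PowerSeries.coeff n (chernSimonsDensitySeries g (redefined g ϑ A)) x))) ∧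
          MeasureTheory.Integrable (traceFF g A) ∧
          chernSimonsSeries g (redefined g ϑ A) =
            PowerSeries.C (chernSimons g A) +
              PowerSeries.X * PowerSeries.C ((1 / 4 : ℂ) * ∫ x, traceFF g A x)) := by
  obtain ⟨ϑ, h1, h2, h3, h4, h⟩ := exists_coefficients g
  refine ⟨ϑ, fun N 𝔤 _ _ => ⟨fun A hA hA' => ⟨fun μ => ?_, fun n _ μ x => ?_, ?_⟩, ?_⟩⟩
  · rw [h1, h2, h3, h4]
    exact ⟨CovTensor.vec_coeff₁ g A μ, CovTensor.vec_coeff₂ g A μ, CovTensor.vec_coeff₃ g A μ,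
      CovTensor.vec_coeff₄ g A μ⟩
  · exact (ϑ n).eval_mem g 𝔤 hA hA' _ x
  · intro c hc _ n _ μ x i j
    exact (ϑ n).hasVariation_eval g hA hc (fun _ => μ) x i j
  · intro A hA _
    let A' : Fin 3 → schwartzFields N := fun μ => ⟨A μ, hA μ⟩
    obtain ⟨h0, hn⟩ := h N A'
    exact ⟨integrable_density g A' h0, integrable_traceFF g A',
      chernSimonsSeries_redefined g A' h0 h1 hn⟩
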